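/- There are universal constants $C>0$ and $c_0>0$ with the following property. Let $P\equiv\min\{c^\top x : Ax=b,\ x\ge 0\}$ be a linear program with $A\in\mathbb{R}^{m\times n}$, $b\in\mathbb{R}^m$, $c\in\mathbb{R}^n$, where $b$, $c$ and all the columns of $A$ have unit Euclidean norm. Assume that its feasible region is nonempty and bounded, and let $\theta$ be such that $P$ has an optimal solution $x^*$ with $\sum_{j=1}^n x^*_j<\theta$. Let $v(P)$ be the optimal value of $P$, let $y^*$ be an optimal solution of minimal Euclidean norm of the dual program $\max\{b^\top y : y^\top A\le c^\top\}$, and let $0<\delta\le|v(P)|$. Let $T$ be a $k\times m$ random projector, that is, $T=\frac{1}{\sqrt{k}}U$ where $U$ is one of the following random $k\times m$ matrices: (1) $\sqrt{m}$ times the orthogonal projection onto a uniformly distributed random $k$-dimensional linear subspace of $\mathbb{R}^m$, written in coordinates with respect to an orthonormal basis of the subspace; (2) a matrix with independent standard normal entries; (3) a matrix with independent entries equal to $\pm1$ with probability $\frac12$ each; (4) a matrix with independent entries equal to $\sqrt3,\,0,\,-\sqrt3$ with probabilities $\frac16,\frac23,\frac16$. Let $$P_{T,\theta}\equiv\min\Big\{c^\top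 x : TAx=Tb,\ \sum_{j=1}^n x_j\le\theta,\ x\ge0\Big\}$$ and let $v(P_{T,\theta})$ be its optimal value. Then, for every $\varepsilon$ with $0<\varepsilon\le c_0\,\dfrac{\delta}{\theta^2\|y^*\|}$, the inequalities $$v(P)-\delta\ \le\ v(P_{T,\theta})\ \le\ v(P)$$ hold with probability at least $1-4n\,e^{-C(\varepsilon^2-\varepsilon^3)k}$. -/

import Mathlib

open MeasureTheory ProbabilityTheory
open scoped Matrix ENNReal

namespace LPProjection

noncomputable section

/-- Euclidean norm of a vector given by its coordinates. -/
def euclNorm {d : ℕ} (v : Fin d → ℝ) : ℝ := ‖WithLp.toLp 2 v‖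

/-! ### Linear programs in standard form -/

/-- The feasible region `{x ≥ 0 : A x = b}` of the linear program
`P = min {cᵀx : A x = b, x ≥ 0}`. -/
def primalFeasible {m n : ℕ} (A : Matrix (Fin m) (Fin n) ℝ) (b : Fin m → ℝ) :
    Set (Fin n → ℝ) :=
  {x | A *ᵥ x = b ∧ ∀ j, 0 ≤ x j}

/-- The feasible region of the linear program `P_{T,θ}`: the constraints `A x = b` are replaced by
the projected ones `T A x = T b`, and the constraint `∑ x_j ≤ θ` is added. -/
def projectedFeasible {k m n : ℕ} (T : Matrix (Fin k) (Fin m) ℝ) (A : Matrix (Fin m) (Fin n) ℝ)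
    (b : Fin m → ℝ) (θ : ℝ) : Set (Fin n → ℝ) :=
  {x | (T * A) *ᵥ x = T *ᵥ b ∧ ∑ j, x j ≤ θ ∧ ∀ j, 0 ≤ x j}

/-- The optimal value of `min {cᵀx : x ∈ F}`. The infimum is a genuine minimum when `F` is
nonempty and compact, as are all the feasible regions to which it is applied. -/
def optValue {n : ℕ} (c : Fin n → ℝ) (F : Set (Fin n → ℝ)) : ℝ :=
  sInf ((fun x => c ⬝ᵥ x) '' F)

/-- `x` is an optimal solution of `min {cᵀx : x ∈ F}`. -/
def IsOptimalSolution {n : ℕ} (c : Fin n → ℝ) (F : Set (Fin n → ℝ)) (x : Fin n → ℝ) : Prop :=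
  x ∈ F ∧ ∀ z ∈ F, c ⬝ᵥ x ≤ c ⬝ᵥ z

/-- The feasible region `{y : yᵀA ≤ cᵀ}` of the dual program `max {bᵀy : yᵀA ≤ cᵀ}`. -/
def dualFeasible {m n : ℕ} (A : Matrix (Fin m) (Fin n) ℝ) (c : Fin n → ℝ) :
    Set (Fin m → ℝ) :=
  {y | ∀ j, (y ᵥ* A) j ≤ c j}

/-- `y` is an optimal solution of the dual program `max {bᵀy : yᵀA ≤ cᵀ}`. -/
def IsDualOptimal {m n : ℕ} (A : Matrix (Fin m) (Fin n) ℝ) (b : Fin m → ℝ) (c : Fin n → ℝ)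
    (y : Fin m → ℝ) : Prop :=
  y ∈ dualFeasible A c ∧ ∀ z ∈ dualFeasible A c, b ⬝ᵥ z ≤ b ⬝ᵥ y

/-- `y` is an optimal dual solution of minimal Euclidean norm. -/
def IsMinNormDualOptimal {m n : ℕ} (A : Matrix (Fin m) (Fin n) ℝ) (b : Fin m → ℝ)
    (c : Fin n → ℝ) (y : Fin m → ℝ) : Prop :=
  IsDualOptimal A b c y ∧ ∀ z, IsDualOptimal A b c z → euclNorm y ≤ euclNorm z

/-! ### Random projectors -/

/-- The uniform distribution on `{+1, -1}`. -/
def signLaw : Measure ℝ :=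
  (1 / 2 : ℝ≥0∞) • Measure.dirac (1 : ℝ) + (1 / 2 : ℝ≥0∞) • Measure.dirac (-1 : ℝ)

/-- The sparse distribution taking the values `+1, 0, -1` with probabilities `1/6, 2/3, 1/6`,
multiplied by `√3` so that its variance is one. -/
def sparseSignLaw : Measure ℝ :=
  (1 / 6 : ℝ≥0∞) • Measure.dirac (√3) + (2 / 3 : ℝ≥0∞) • Measure.dirac (0 : ℝ) +
    (1 / 6 : ℝ≥0∞) • Measure.dirac (-√3)

/-- The entries of the random matrix `U` are independent with common distribution `ν`. -/
def HasIIDEntries {Ω : Type*} [MeasurableSpace Ω] {k m : ℕ}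
    (U : Ω → Matrix (Fin k) (Fin m) ℝ) (ν : Measure ℝ) (μ : Measure Ω) : Prop :=
  (∀ i j, HasLaw (fun ω => U ω i j) ν μ) ∧
    iIndepFun (fun (p : Fin k × Fin m) ω => U ω p.1 p.2) μ

/-- `Q` is the orthogonal projection of `ℝᵐ` onto a uniformly distributed random `k`-dimensional
linear subspace, written in coordinates with respect to an orthonormal basis of that subspace.
The rows of `Q` are orthonormal, so `QᵀQ` is the `m × m` matrix of the orthogonal projection onto
the row space of `Q`; for an orthogonal matrix `R` the matrix `R (QᵀQ) Rᵀ` is the projection onto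
the rotated subspace, and the uniform distribution on the `k`-dimensional subspaces is the unique
one that is invariant under all rotations and reflections `R`. -/
def IsRandomSubspaceProjection {Ω : Type*} [MeasurableSpace Ω] {k m : ℕ}
    (Q : Ω → Matrix (Fin k) (Fin m) ℝ) (μ : Measure Ω) : Prop :=
  (∀ i j, AEMeasurable (fun ω => Q ω i j) μ) ∧
    (∀ᵐ ω ∂μ, Q ω * (Q ω)ᵀ = 1) ∧
    ∀ R ∈ Matrix.orthogonalGroup (Fin m) ℝ,
      IdentDistrib
        (fun ω => fun p : Fin m × Fin m => (R * ((Q ω)ᵀ * Q ω) * Rᵀ) p.1 p.2)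
        (fun ω => fun p : Fin m × Fin m => ((Q ω)ᵀ * Q ω) p.1 p.2) μ μ

/-- `T` is a `k × m` random projector: `T = U / √k`, where `U` is one of
1. the orthogonal projection onto a random `k`-dimensional subspace, multiplied by `√m`;
2. a matrix of independent standard normal entries;
3. a matrix of independent uniformly distributed signs;
4. a matrix of independent sparse signs.
The factors `√m` in 1 and `√3` in 4 are the normalization for which `T` preserves squared
Euclidean norms in expectation; the constraints `T A x = T b` do not depend on them. -/
def IsRandomProjector {Ω : Type*} [MeasurableSpace Ω] {k m : ℕ}
    (T : Ω → Matrix (Fin k) (Fin m) ℝ) (μ : Measure Ω) : Prop :=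
  ∃ U : Ω → Matrix (Fin k) (Fin m) ℝ,
    (∀ ω, T ω = (1 / √(k : ℝ)) • U ω) ∧
    ((∃ Q : Ω → Matrix (Fin k) (Fin m) ℝ,
        IsRandomSubspaceProjection Q μ ∧ ∀ ω, U ω = √(m : ℝ) • Q ω) ∨
      HasIIDEntries U (gaussianReal 0 1) μ ∨
      HasIIDEntries U signLaw μ ∨
      HasIIDEntries U sparseSignLaw μ)

end

end LPProjection

/-! The optimal solution of `P` satisfies the projected constraints for every `T`, so the upper
bound is deterministic. For the lower bound, a feasible `z` of the projected program satisfies `c·z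
≥ y*·Az` by dual feasibility, and `y*·b = v(P)` by strong duality. It thus suffices that `y*·(Az -
b) ≥ -δ`. Since `TAz = Tb`, this residual vanishes once inner products are taken after projection.
It is therefore at most `‖y*‖ ε (θ + 1)` in size if `T` preserves the inner products of `y*/‖y*‖`
with `b` and the columns of `A` up to `ε`.

Inner products are controlled through the norms of sums and differences, using the
Johnson–Lindenstrauss property (`exists_measure_norm_distortion_le`) and a union bound. For
independent entries that property is Bernstein's inequality for squares of sub-Gaussian variables
(`exists_measure_sum_sq_le`). For a random subspace, invariance allows the fixed vector to be
replaced by an independent Gaussian one. Fubini then reduces the claim to a fixed subspace and a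
Gaussian vector (`exists_stdGaussianPi_distortion_le`).

Strong duality comes from separating a point from a closed cone, with boundedness of the feasible
region giving the closedness. -/

namespace LPProjection

/-! ### Concentration of sums of squares of sub-Gaussian variables -/

/-- Square-exponential moments of sub-Gaussian variables are bounded uniformly. -/
lemma exists_integral_exp_sq_le :
    ∃ a > (0 : ℝ), ∃ B > (0 : ℝ), ∀ {Ω : Type*} [MeasurableSpace Ω] (μ : Measure Ω)
      [IsProbabilityMeasure μ] (X : Ω → ℝ), HasSubgaussianMGF X 3 μ →
        Integrable (fun ω => Real.exp (a * X ω ^ 2)) μ ∧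
          ∫ ω, Real.exp (a * X ω ^ 2) ∂μ ≤ B := by
  obtain ⟨C, hC, hint⟩ := IsGaussian.exists_integrable_exp_sq (gaussianReal 0 1)
  set B := ∫ g, Real.exp (C * ‖g‖ ^ 2) ∂(gaussianReal 0 1) with hB
  refine ⟨C / 3, by positivity, B, integral_exp_pos hint, ?_⟩
  intro Ω _ μ _ X hX
  have hXm : AEMeasurable X μ := hX.aemeasurable
  set s := √(2 * C / 3)
  have hs : s ^ 2 = 2 * C / 3 := Real.sq_sqrt (by positivity)
  -- Gaussian linearization: `exp (s² X² / 2)` is the Gaussian average of `exp (s X g)`. After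
  -- exchanging the integrals, the sub-Gaussian bound gives `exp (3 s² g² / 2) = exp (C g²)`, which
  -- is integrable by Fernique's theorem.
  have key : ∫⁻ ω, ENNReal.ofReal (Real.exp (C / 3 * X ω ^ 2)) ∂μ ≤ ENNReal.ofReal B := by
    calc ∫⁻ ω, ENNReal.ofReal (Real.exp (C / 3 * X ω ^ 2)) ∂μ
        = ∫⁻ ω, ∫⁻ g, ENNReal.ofReal (Real.exp (s * X ω * g)) ∂(gaussianReal 0 1) ∂μ := by
          refine lintegral_congr fun ω => ?_
          rw [← ofReal_integral_eq_lintegral_ofReal (integrable_exp_mul_gaussianReal _)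
            (ae_of_all _ fun _ => (Real.exp_pos _).le)]
          have := congrFun (mgf_id_gaussianReal (μ := 0) (v := 1)) (s * X ω)
          simp only [mgf, id] at this
          rw [this, mul_pow, hs]
          congr 2
          push_cast
          ring
      _ = ∫⁻ g, ∫⁻ ω, ENNReal.ofReal (Real.exp (s * X ω * g)) ∂μ ∂(gaussianReal 0 1) := by
          refine lintegral_lintegral_swap ?_
          have h1 : AEMeasurable (fun p : Ω × ℝ => X p.1) (μ.prod (gaussianReal 0 1)) :=
            hXm.comp_fst
          have h2 : AEMeasurable (fun p : Ω × ℝ => p.2) (μ.prod (gaussianReal 0 1)) :=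
            measurable_snd.aemeasurable
          exact (Real.measurable_exp.comp_aemeasurable ((h1.const_mul s).mul h2)).ennreal_ofReal
      _ ≤ ∫⁻ g, ENNReal.ofReal (Real.exp (C * ‖g‖ ^ 2)) ∂(gaussianReal 0 1) := by
          refine lintegral_mono fun g => ?_
          have h1 : ∀ ω, s * X ω * g = s * g * X ω := fun ω => by ring
          simp only [h1]
          rw [← ofReal_integral_eq_lintegral_ofReal (hX.integrable_exp_mul _)
            (ae_of_all _ fun _ => (Real.exp_pos _).le)]
          refine ENNReal.ofReal_le_ofReal ((hX.mgf_le (s * g)).trans (le_of_eq ?_))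
          rw [mul_pow, hs, Real.norm_eq_abs, sq_abs]
          congr 1
          push_cast
          ring
      _ = ENNReal.ofReal B := by
          rw [ofReal_integral_eq_lintegral_ofReal hint (ae_of_all _ fun _ => (Real.exp_pos _).le)]
  have hm : AEStronglyMeasurable (fun ω => Real.exp (C / 3 * X ω ^ 2)) μ := by
    exact (Real.measurable_exp.comp_aemeasurable
      ((hXm.pow_const 2).const_mul (C / 3))).aestronglyMeasurable
  have hi : Integrable (fun ω => Real.exp (C / 3 * X ω ^ 2)) μ := by
    refine ⟨hm, ?_⟩
    rw [hasFiniteIntegral_iff_ofReal (ae_of_all _ fun _ => (Real.exp_pos _).le)]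
    exact key.trans_lt ENNReal.ofReal_lt_top
  refine ⟨hi, ?_⟩
  rw [← ofReal_integral_eq_lintegral_ofReal hi (ae_of_all _ fun _ => (Real.exp_pos _).le)] at key
  exact (ENNReal.ofReal_le_ofReal_iff (integral_exp_pos hint).le).1 key

lemma abs_exp_sub_one_sub_le (z : ℝ) : |Real.exp z - 1 - z| ≤ z ^ 2 * Real.exp |z| := by
  have := Complex.norm_exp_sub_sum_le_norm_mul_exp (z : ℂ) 2
  simp only [Finset.sum_range_succ, Finset.sum_range_zero, pow_zero, Nat.factorial] at this
  norm_num at this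
  rw [← Complex.ofReal_exp, ← Complex.ofReal_one, ← Complex.ofReal_add, ← Complex.ofReal_sub,
    Complex.norm_real, Real.norm_eq_abs] at this
  rwa [sub_sub]

/-- Local moment generating function bound for centred squares of sub-Gaussian variables. -/
lemma exists_mgf_sq_sub_one_le :
    ∃ a > (0 : ℝ), ∃ K > (0 : ℝ), ∀ {Ω : Type*} [MeasurableSpace Ω] (μ : Measure Ω)
      [IsProbabilityMeasure μ] (X : Ω → ℝ), HasSubgaussianMGF X 3 μ → ∫ ω, X ω ^ 2 ∂μ = 1 →
        ∀ t : ℝ, |t| ≤ a → Integrable (fun ω => Real.exp (t * (X ω ^ 2 - 1))) μ ∧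
          mgf (fun ω => X ω ^ 2 - 1) μ t ≤ Real.exp (K * t ^ 2) := by
  obtain ⟨a, ha, B, hB, h⟩ := exists_integral_exp_sq_le
  refine ⟨a / 2, by positivity, 8 / a ^ 2 * Real.exp a * B, by positivity, ?_⟩
  intro Ω _ μ _ X hX hX2 t ht
  obtain ⟨hi, hle⟩ := h μ X hX
  have hXm : AEMeasurable X μ := hX.aemeasurable
  have hsq : Integrable (fun ω => X ω ^ 2) μ := (hX.memLp 2).integrable_sq
  -- Second-order Taylor remainder. One half of the exponent `a` absorbs `exp (|t| Z)`, the other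
  -- half absorbs `Z²`. The linear term later integrates to zero because `X²` has mean one.
  have hbd : ∀ x : ℝ, |Real.exp (t * (x ^ 2 - 1)) - 1 - t * (x ^ 2 - 1)| ≤
      t ^ 2 * (8 / a ^ 2 * Real.exp a * Real.exp (a * x ^ 2)) := by
    intro x
    set Z := |x ^ 2 - 1|
    have hZ : Z ≤ x ^ 2 + 1 := by
      rw [abs_le]; constructor <;> nlinarith [sq_nonneg x]
    have hZ0 : 0 ≤ Z := abs_nonneg _
    have h1 := abs_exp_sub_one_sub_le (t * (x ^ 2 - 1))
    refine h1.trans ?_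
    rw [mul_pow, ← sq_abs (x ^ 2 - 1), abs_mul, mul_assoc]
    refine mul_le_mul_of_nonneg_left ?_ (sq_nonneg t)
    have h2 : Real.exp (|t| * Z) ≤ Real.exp (a / 2 * Z) := by gcongr
    have h3 : (a / 2 * Z) ^ 2 / 2 ≤ Real.exp (a / 2 * Z) :=
      by have := Real.quadratic_le_exp_of_nonneg (x := a / 2 * Z) (by positivity)
         have : 0 ≤ a / 2 * Z := by positivity
         linarith
    have h4 : Z ^ 2 ≤ 8 / a ^ 2 * Real.exp (a / 2 * Z) := by
      have : Z ^ 2 = 8 / a ^ 2 * ((a / 2 * Z) ^ 2 / 2) := by field_simp; ring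
      rw [this]
      gcongr
    calc Z ^ 2 * Real.exp (|t| * Z)
        ≤ 8 / a ^ 2 * Real.exp (a / 2 * Z) * Real.exp (a / 2 * Z) := by gcongr
      _ = 8 / a ^ 2 * Real.exp (a * Z) := by
          rw [mul_assoc, ← Real.exp_add]; congr 2; ring
      _ ≤ 8 / a ^ 2 * Real.exp (a * (x ^ 2 + 1)) := by gcongr
      _ = _ := by rw [mul_add, mul_one, add_comm, Real.exp_add]; ring
  have hlin : Integrable (fun ω => t * (X ω ^ 2 - 1)) μ :=
    (hsq.sub (integrable_const 1)).const_mul t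
  have hmaj : Integrable (fun ω => t ^ 2 * (8 / a ^ 2 * Real.exp a * Real.exp (a * X ω ^ 2))) μ :=
    (hi.const_mul _).const_mul _
  have haff : Integrable (fun ω => 1 + t * (X ω ^ 2 - 1)) μ := (integrable_const 1).add hlin
  have hdom : Integrable (fun ω => 1 + t * (X ω ^ 2 - 1) +
      t ^ 2 * (8 / a ^ 2 * Real.exp a * Real.exp (a * X ω ^ 2))) μ :=
    haff.add hmaj
  have hpt : ∀ x : ℝ, Real.exp (t * (x ^ 2 - 1)) ≤ 1 + t * (x ^ 2 - 1) +
      t ^ 2 * (8 / a ^ 2 * Real.exp a * Real.exp (a * x ^ 2)) := by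
    intro x
    linarith [(abs_le.1 (hbd x)).2]
  have hint : Integrable (fun ω => Real.exp (t * (X ω ^ 2 - 1))) μ := by
    refine hdom.mono' ?_ (ae_of_all _ fun ω => ?_)
    · exact (Real.measurable_exp.comp_aemeasurable
        (((hXm.pow_const 2).sub_const 1).const_mul t)).aestronglyMeasurable
    · rw [Real.norm_eq_abs, abs_of_pos (Real.exp_pos _)]
      exact hpt _
  refine ⟨hint, ?_⟩
  have hle2 := integral_mono hint hdom fun ω => hpt (X ω)
  rw [integral_add haff hmaj, integral_add (integrable_const 1) hlin,
    integral_const_mul, integral_const_mul, integral_const_mul, integral_sub hsq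
    (integrable_const 1), hX2] at hle2
  simp only [integral_const, probReal_univ, one_smul, sub_self, mul_zero, add_zero] at hle2
  calc mgf (fun ω => X ω ^ 2 - 1) μ t ≤ _ := hle2
    _ ≤ 1 + t ^ 2 * (8 / a ^ 2 * Real.exp a * B) := by gcongr
    _ ≤ Real.exp (8 / a ^ 2 * Real.exp a * B * t ^ 2) := by
        have := Real.add_one_le_exp (8 / a ^ 2 * Real.exp a * B * t ^ 2)
        linarith

/-- Bernstein's inequality for sums of squares of independent sub-Gaussian variables. -/
lemma exists_measure_sum_sq_le :
    ∃ C > (0 : ℝ), ∀ {Ω : Type*} [MeasurableSpace Ω] (μ : Measure Ω)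
      [IsProbabilityMeasure μ] (k : ℕ) (X : Fin k → Ω → ℝ), (∀ i, Measurable (X i)) →
      iIndepFun X μ → (∀ i, HasSubgaussianMGF (X i) 3 μ) → (∀ i, ∫ ω, X i ω ^ 2 ∂μ = 1) →
      ∀ ε : ℝ, 0 < ε → ε ≤ 1 →
        μ.real {ω | k * ε ≤ |∑ i, X i ω ^ 2 - k|} ≤ 2 * Real.exp (-C * ε ^ 2 * k) := by
  obtain ⟨a, ha, K, hK, h⟩ := exists_mgf_sq_sub_one_le
  -- The Chernoff exponent `-t ε + L t²` is smallest at `t = ε / (2L)`. The lower bound on `L` keeps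
  -- this `t` in the range `t ≤ a` when `ε ≤ 1`.
  set L := max K (1 / (2 * a))
  have hKL : K ≤ L := le_max_left _ _
  have haL : 1 / (2 * a) ≤ L := le_max_right _ _
  have hL : 0 < L := hK.trans_le hKL
  refine ⟨1 / (4 * L), by positivity, ?_⟩
  intro Ω _ μ _ k X hXm hind hsub hsq ε hε hε1
  set Y : Fin k → Ω → ℝ := fun i ω => X i ω ^ 2 - 1 with hY
  have hYm : ∀ i, Measurable (Y i) := fun i => ((hXm i).pow_const 2).sub_const 1
  have hYind : iIndepFun Y μ :=
    hind.comp (fun _ x => x ^ 2 - 1) fun _ => (measurable_id.pow_const 2).sub_const 1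
  set t := ε / (2 * L) with ht_def
  have ht : 0 < t := by positivity
  have hta : t ≤ a := by
    rw [ht_def, div_le_iff₀ (by positivity)]
    rw [div_le_iff₀ (by positivity)] at haL
    nlinarith
  have hmgf : ∀ s : ℝ, |s| = t → Integrable (fun ω => Real.exp (s * (∑ i, Y i) ω)) μ ∧
      mgf (∑ i, Y i) μ s ≤ Real.exp (L * t ^ 2 * k) := by
    intro s hs
    have hsa : |s| ≤ a := hs ▸ hta
    have hi := fun i => h μ (X i) (hsub i) (hsq i) s hsa
    constructor
    · refine (hYind.integrable_exp_mul_sum hYm) fun i _ => (hi i).1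
    · rw [hYind.mgf_sum hYm]
      calc ∏ i, mgf (Y i) μ s ≤ ∏ _i : Fin k, Real.exp (L * t ^ 2) := by
            refine Finset.prod_le_prod (fun i _ => mgf_nonneg) fun i _ => ?_
            refine ((hi i).2).trans ?_
            rw [← hs, sq_abs]
            gcongr
        _ = _ := by
            rw [Finset.prod_const, Finset.card_univ, Fintype.card_fin, ← Real.exp_nat_mul]
            congr 1
            ring
  have hfin : -t * (k * ε) + L * t ^ 2 * k = -(1 / (4 * L)) * ε ^ 2 * k := by
    rw [ht_def]; field_simp; ring
  have hup : μ.real {ω | k * ε ≤ (∑ i, Y i) ω} ≤ Real.exp (-(1 / (4 * L)) * ε ^ 2 * k) := by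
    obtain ⟨hi, hm⟩ := hmgf t (abs_of_pos ht)
    refine (measure_ge_le_exp_mul_mgf _ ht.le hi).trans ?_
    rw [← hfin, Real.exp_add]
    gcongr
  have hlo : μ.real {ω | (∑ i, Y i) ω ≤ -(k * ε)} ≤ Real.exp (-(1 / (4 * L)) * ε ^ 2 * k) := by
    obtain ⟨hi, hm⟩ := hmgf (-t) (by rw [abs_neg, abs_of_pos ht])
    refine (measure_le_le_exp_mul_mgf _ (by linarith) hi).trans ?_
    rw [← hfin, Real.exp_add, neg_neg, mul_neg, neg_mul]
    gcongr
  calc μ.real {ω | k * ε ≤ |∑ i, X i ω ^ 2 - k|}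
      ≤ μ.real ({ω | k * ε ≤ (∑ i, Y i) ω} ∪ {ω | (∑ i, Y i) ω ≤ -(k * ε)}) := by
        refine measureReal_mono fun ω hω => ?_
        have e : (∑ i, Y i) ω = ∑ i, X i ω ^ 2 - k := by
          simp [hY, Finset.sum_sub_distrib]
        simp only [Set.mem_ofPred_eq, Set.mem_union, e] at hω ⊢
        rcases le_abs.1 hω with h | h
        · exact Or.inl h
        · exact Or.inr (by linarith)
    _ ≤ _ := measureReal_union_le _ _
    _ ≤ _ := by linarith

/-! ### The three entry laws -/

/-- A centred law of variance one which is sub-Gaussian with parameter three. -/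
structure IsStandardSubgaussian (ν : Measure ℝ) : Prop where
  isProbabilityMeasure : IsProbabilityMeasure ν
  hasSubgaussianMGF : HasSubgaussianMGF id 3 ν
  integral_id : ∫ x, x ∂ν = 0
  integral_sq : ∫ x, x ^ 2 ∂ν = 1

lemma isStandardSubgaussian_gaussianReal : IsStandardSubgaussian (gaussianReal 0 1) where
  isProbabilityMeasure := inferInstance
  hasSubgaussianMGF :=
    { integrable_exp_mul := fun t => integrable_exp_mul_gaussianReal t
      mgf_le := fun t => by
        rw [mgf_id_gaussianReal]
        simp only [NNReal.coe_one, zero_mul, zero_add, one_mul, NNReal.coe_ofNat]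
        gcongr
        linarith [sq_nonneg t] }
  integral_id := integral_id_gaussianReal
  integral_sq := by
    have h := variance_id_gaussianReal (μ := 0) (v := 1)
    rw [variance_of_integral_eq_zero aemeasurable_id (by simp)] at h
    simpa using h

/-- Hoeffding's lemma on an interval of length `2√3` gives the parameter `(2√3 / 2)² = 3`. The
sparse signs force this value, and it also covers the signs and the Gaussian. -/
lemma hasSubgaussianMGF_of_ae_abs_le {ν : Measure ℝ} [IsProbabilityMeasure ν]
    (hb : ∀ᵐ x ∂ν, x ∈ Set.Icc (-√3) (√3)) (h0 : ∫ x, x ∂ν = 0) :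
    HasSubgaussianMGF id 3 ν := by
  have h := hasSubgaussianMGF_of_mem_Icc_of_integral_eq_zero aemeasurable_id hb h0
  convert h using 1
  ext
  push_cast
  rw [show √3 - -√3 = 2 * √3 by ring, Real.norm_of_nonneg (by positivity),
    mul_div_cancel_left₀ _ two_ne_zero, Real.sq_sqrt (by norm_num)]

lemma isProbabilityMeasure_signLaw : IsProbabilityMeasure signLaw := by
  constructor
  simp [signLaw, ENNReal.inv_two_add_inv_two]

lemma isProbabilityMeasure_sparseSignLaw : IsProbabilityMeasure sparseSignLaw := by
  constructor
  simp only [sparseSignLaw, Measure.coe_add, Measure.coe_smul, Pi.add_apply, Pi.smul_apply,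
    measure_univ, smul_eq_mul, mul_one]
  rw [← ENNReal.toReal_eq_one_iff, ENNReal.toReal_add (by finiteness) (by finiteness),
    ENNReal.toReal_add (by finiteness) (by finiteness)]
  norm_num [ENNReal.toReal_div]

lemma integral_signLaw (f : ℝ → ℝ) : ∫ x, f x ∂signLaw = (f 1 + f (-1)) / 2 := by
  rw [signLaw, integral_add_measure, integral_smul_measure, integral_smul_measure,
    integral_dirac, integral_dirac]
  · norm_num [ENNReal.toReal_div]; ring
  · exact (integrable_dirac (by simp)).smul_measure (by finiteness)
  · exact (integrable_dirac (by simp)).smul_measure (by finiteness)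

lemma integral_sparseSignLaw (f : ℝ → ℝ) :
    ∫ x, f x ∂sparseSignLaw = f (√3) / 6 + 2 * f 0 / 3 + f (-√3) / 6 := by
  have h : ∀ (c : ℝ≥0∞) (_ : c ≠ ⊤) (x : ℝ), Integrable f (c • Measure.dirac x) :=
    fun c hc x => (integrable_dirac (by simp)).smul_measure hc
  rw [sparseSignLaw, integral_add_measure ((h _ (by finiteness) _).add_measure
    (h _ (by finiteness) _)) (h _ (by finiteness) _), integral_add_measure (h _ (by finiteness) _)
    (h _ (by finiteness) _), integral_smul_measure, integral_smul_measure, integral_smul_measure,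
    integral_dirac, integral_dirac, integral_dirac]
  norm_num [ENNReal.toReal_div]; ring

lemma isStandardSubgaussian_signLaw : IsStandardSubgaussian signLaw := by
  have := isProbabilityMeasure_signLaw
  have h0 : ∫ x, x ∂signLaw = 0 := by rw [integral_signLaw]; norm_num
  refine ⟨this, hasSubgaussianMGF_of_ae_abs_le ?_ h0, h0, ?_⟩
  · have h1 : (1 : ℝ) ≤ √3 := Real.one_le_sqrt.2 (by norm_num)
    have hs : MeasurableSet {x : ℝ | x ∈ Set.Icc (-√3) (√3)} := measurableSet_Icc
    rw [signLaw, ae_add_measure_iff]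
    constructor <;> refine Measure.ae_smul_measure ((ae_dirac_iff hs).2 ?_) _ <;>
      constructor <;> linarith
  · rw [integral_signLaw]; norm_num

lemma isStandardSubgaussian_sparseSignLaw : IsStandardSubgaussian sparseSignLaw := by
  have := isProbabilityMeasure_sparseSignLaw
  have h0 : ∫ x, x ∂sparseSignLaw = 0 := by rw [integral_sparseSignLaw]; ring
  refine ⟨this, hasSubgaussianMGF_of_ae_abs_le ?_ h0, h0, ?_⟩
  · have h1 : (0 : ℝ) ≤ √3 := Real.sqrt_nonneg 3
    have hs : MeasurableSet {x : ℝ | x ∈ Set.Icc (-√3) (√3)} := measurableSet_Icc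
    rw [sparseSignLaw, ae_add_measure_iff, ae_add_measure_iff]
    refine ⟨⟨?_, ?_⟩, ?_⟩ <;> refine Measure.ae_smul_measure ((ae_dirac_iff hs).2 ?_) _ <;>
      constructor <;> linarith
  · rw [integral_sparseSignLaw]; norm_num

/-! ### Norm distortion for independent entries -/

lemma measurable_dotProduct_right {m : ℕ} (u : Fin m → ℝ) :
    Measurable fun x : Fin m → ℝ => u ⬝ᵥ x := by
  simp only [dotProduct]
  fun_prop

section Pi

variable {ν : Measure ℝ} {m : ℕ}

/-- Parameters of independent summands add up: `∑ 3 u_j² = 3`. The parameter is therefore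
independent of the dimension and of the direction `u`. -/
lemma IsStandardSubgaussian.hasSubgaussianMGF_dotProduct (hν : IsStandardSubgaussian ν)
    {u : Fin m → ℝ} (hu : u ⬝ᵥ u = 1) :
    HasSubgaussianMGF (fun x => u ⬝ᵥ x) 3 (Measure.pi fun _ : Fin m => ν) := by
  have := hν.isProbabilityMeasure
  have hind : iIndepFun (fun (j : Fin m) (x : Fin m → ℝ) => u j * x j)
      (Measure.pi fun _ : Fin m => ν) :=
    iIndepFun_pi (X := fun j (x : ℝ) => u j * x) fun j => by fun_prop
  have hj : ∀ j : Fin m, HasSubgaussianMGF (fun x : Fin m → ℝ => u j * x j)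
      (‖u j‖₊ ^ 2 * 3) (Measure.pi fun _ : Fin m => ν) := by
    intro j
    have e : (NNReal.mk (u j ^ 2) (sq_nonneg _)) = ‖u j‖₊ ^ 2 := NNReal.eq (by simp)
    rw [← e]
    refine HasSubgaussianMGF.const_mul (X := fun x : Fin m → ℝ => x j) ?_ (u j)
    refine HasSubgaussianMGF.of_map (X := id) (measurable_pi_apply j).aemeasurable ?_
    rw [(measurePreserving_eval (fun _ : Fin m => ν) j).map_eq]
    exact hν.hasSubgaussianMGF
  have h := HasSubgaussianMGF.sum_of_iIndepFun hind (s := Finset.univ) fun j _ => hj j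
  have hsum : ∑ j, ‖u j‖₊ ^ 2 * 3 = 3 := by
    ext
    push_cast
    have : ∑ j, u j ^ 2 = 1 := by rw [← hu]; simp [dotProduct, sq]
    simp [← Finset.sum_mul, this]
  rw [hsum] at h
  exact h

lemma IsStandardSubgaussian.memLp_id (hν : IsStandardSubgaussian ν) : MemLp id 2 ν := by
  have := hν.isProbabilityMeasure
  exact_mod_cast hν.hasSubgaussianMGF.memLp 2

lemma IsStandardSubgaussian.integral_dotProduct_sq (hν : IsStandardSubgaussian ν)
    {u : Fin m → ℝ} (hu : u ⬝ᵥ u = 1) :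
    ∫ x, (u ⬝ᵥ x) ^ 2 ∂(Measure.pi fun _ : Fin m => ν) = 1 := by
  have := hν.isProbabilityMeasure
  have hL : ∀ j, MemLp (fun x : ℝ => u j * x) 2 ν := fun j => hν.memLp_id.const_mul (u j)
  have hv := variance_sum_pi (μ := fun _ : Fin m => ν) (X := fun j (x : ℝ) => u j * x) hL
  have hcoord : ∀ j, Var[fun x : ℝ => u j * x; ν] = u j * u j := by
    intro j
    rw [variance_of_integral_eq_zero (by fun_prop)
      (by rw [integral_const_mul, hν.integral_id, mul_zero])]
    simp only [mul_pow]
    rw [integral_const_mul, hν.integral_sq]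
    ring
  have hf : (∑ j, fun x : Fin m → ℝ => u j * x j) = fun x => u ⬝ᵥ x := by
    ext x; simp [dotProduct]
  rw [hf] at hv
  simp only [hcoord] at hv
  have hint : ∀ j, Integrable (fun x : Fin m → ℝ => u j * x j) (Measure.pi fun _ : Fin m => ν) :=
    fun j => ((measurePreserving_eval (fun _ : Fin m => ν) j).integrable_comp_of_integrable
      (hν.memLp_id.integrable (by norm_num))).const_mul (u j)
  have h0 : ∫ x, u ⬝ᵥ x ∂(Measure.pi fun _ : Fin m => ν) = 0 := by
    simp only [dotProduct]
    rw [integral_finsetSum _ fun j _ => hint j]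
    refine Finset.sum_eq_zero fun j _ => ?_
    rw [integral_const_mul, integral_comp_eval (μ := fun _ : Fin m => ν) (f := fun x : ℝ => x)
      aestronglyMeasurable_id, hν.integral_id, mul_zero]
  rw [variance_of_integral_eq_zero (by fun_prop) h0] at hv
  rw [hv]
  exact hu

end Pi

/-- Independent entries, viewed as a random family of rows, have the iterated product law. -/
lemma hasLaw_pi_pi_of_hasIIDEntries {Ω : Type*} [MeasurableSpace Ω] {μ : Measure Ω} {k m : ℕ}
    {U : Ω → Matrix (Fin k) (Fin m) ℝ} {ν : Measure ℝ} [IsProbabilityMeasure ν]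
    (hU : HasIIDEntries U ν μ) :
    HasLaw (fun ω (p : Fin k × Fin m) => U ω p.1 p.2)
      ((Measure.pi fun _ : Fin k => Measure.pi fun _ : Fin m => ν).map
        fun W (p : Fin k × Fin m) => W p.1 p.2) μ := by
  have h := hU.2.hasLaw_pi (μ := fun _ => ν) fun p : Fin k × Fin m => hU.1 p.1 p.2
  convert h
  have hpi : ∀ i : Fin k, MeasurePreserving (fun W : Fin k → Fin m → ℝ => W i)
      (Measure.pi fun _ : Fin k => Measure.pi fun _ : Fin m => ν)
      (Measure.pi fun _ : Fin m => ν) :=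
    fun i => measurePreserving_eval (fun _ : Fin k => Measure.pi fun _ : Fin m => ν) i
  have hentry : ∀ p : Fin k × Fin m, MeasurePreserving (fun W : Fin k → Fin m → ℝ => W p.1 p.2)
      (Measure.pi fun _ : Fin k => Measure.pi fun _ : Fin m => ν) ν :=
    fun p => (measurePreserving_eval (fun _ : Fin m => ν) p.2).comp (hpi p.1)
  have hind := iIndepFun_uncurry' (P := Measure.pi fun _ : Fin k => Measure.pi fun _ : Fin m => ν)
    (X := fun (i : Fin k) (j : Fin m) (W : Fin k → Fin m → ℝ) => W i j) (by fun_prop)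
    (iIndepFun_pi (X := fun (_ : Fin k) (x : Fin m → ℝ) => x) fun i => aemeasurable_id)
    (fun i => (iIndepFun_iff_hasLaw_pi_pi fun j => (hentry (i, j)).hasLaw).2 (hpi i).hasLaw)
  have hlaw := hind.hasLaw_pi (μ := fun _ => ν) fun p : Fin k × Fin m => (hentry p).hasLaw
  exact hlaw.map_eq

/-- The squared Euclidean norm of `(1 / √k) • V x`. -/
lemma smul_mulVec_dotProduct_self {k m : ℕ} (U : Matrix (Fin k) (Fin m) ℝ) (x : Fin m → ℝ) :
    (((1 / √(k : ℝ)) • U) *ᵥ x) ⬝ᵥ (((1 / √(k : ℝ)) • U) *ᵥ x) = (∑ i, (x ⬝ᵥ U i) ^ 2) / k := by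
  rw [Matrix.smul_mulVec, dotProduct_smul, smul_dotProduct, smul_smul, smul_eq_mul,
    ← sq, div_pow, Real.sq_sqrt (Nat.cast_nonneg k), one_pow, div_mul_eq_mul_div, one_mul]
  congr 1
  simp only [dotProduct, Matrix.mulVec, sq, mul_comm]

/-- The squared norm of the image of `x` is the average of `k` squares `(x ⬝ᵥ U i)²`. Under the
iterated product law the rows are independent, so Bernstein's inequality applies. -/
lemma exists_measure_norm_distortion_le_of_iid :
    ∃ C > (0 : ℝ), ∀ {Ω : Type*} [MeasurableSpace Ω] (μ : Measure Ω) [IsProbabilityMeasure μ]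
      {k m : ℕ} (U : Ω → Matrix (Fin k) (Fin m) ℝ) (ν : Measure ℝ), IsStandardSubgaussian ν →
      HasIIDEntries U ν μ → ∀ x : Fin m → ℝ, x ⬝ᵥ x = 1 → ∀ ε : ℝ, 0 < ε → ε ≤ 1 →
        μ.real {ω | ε ≤ |(((1 / √(k : ℝ)) • U ω) *ᵥ x) ⬝ᵥ (((1 / √(k : ℝ)) • U ω) *ᵥ x) - 1|} ≤
          2 * Real.exp (-C * ε ^ 2 * k) := by
  obtain ⟨C, hC, h⟩ := exists_measure_sum_sq_le
  refine ⟨C, hC, ?_⟩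
  intro Ω _ μ _ k m U ν hν hU x hx ε hε hε1
  have := hν.isProbabilityMeasure
  -- For `k = 0` the claimed bound is `2`, which is trivial.
  rcases Nat.eq_zero_or_pos k with rfl | hk
  · simp only [Nat.cast_zero, mul_zero, Real.exp_zero]
    exact measureReal_le_one.trans (by norm_num)
  have hk' : (0 : ℝ) < k := Nat.cast_pos.2 hk
  have hset : MeasurableSet
      {V : Fin k × Fin m → ℝ | k * ε ≤ |∑ i, (∑ j, x j * V (i, j)) ^ 2 - k|} :=
    measurableSet_le (by fun_prop) (by fun_prop)
  have h1 : {ω | ε ≤ |(((1 / √(k : ℝ)) • U ω) *ᵥ x) ⬝ᵥ (((1 / √(k : ℝ)) • U ω) *ᵥ x) - 1|} =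
      {ω | (fun V : Fin k × Fin m → ℝ => k * ε ≤ |∑ i, (∑ j, x j * V (i, j)) ^ 2 - k|)
        (fun p => U ω p.1 p.2)} := by
    ext ω
    simp only [Set.mem_ofPred_eq, smul_mulVec_dotProduct_self]
    rw [div_sub_one hk'.ne', abs_div, abs_of_pos hk', le_div_iff₀ hk', mul_comm]
    simp only [dotProduct]
  rw [h1, (hasLaw_pi_pi_of_hasIIDEntries hU).measureReal_eq hset,
    map_measureReal_apply (by fun_prop) hset]
  set P := Measure.pi fun _ : Fin k => Measure.pi fun _ : Fin m => ν
  have hpi : ∀ i : Fin k, MeasurePreserving (fun W : Fin k → Fin m → ℝ => W i) P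
      (Measure.pi fun _ : Fin m => ν) :=
    fun i => measurePreserving_eval (fun _ : Fin k => Measure.pi fun _ : Fin m => ν) i
  refine h P k (fun i W => x ⬝ᵥ W i) (fun i => ?_) ?_ (fun i => ?_) (fun i => ?_) ε hε hε1
  · exact (measurable_dotProduct_right x).comp (measurable_pi_apply i)
  · exact iIndepFun_pi (X := fun (_ : Fin k) (w : Fin m → ℝ) => x ⬝ᵥ w) fun _ =>
      (measurable_dotProduct_right x).aemeasurable
  · refine HasSubgaussianMGF.of_map (X := fun w => x ⬝ᵥ w) (hpi i).measurable.aemeasurable ?_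
    rw [(hpi i).map_eq]
    exact hν.hasSubgaussianMGF_dotProduct hx
  · rw [← hν.integral_dotProduct_sq hx, ← (hpi i).map_eq, integral_map (hpi i).measurable.aemeasurable]
    exact ((measurable_dotProduct_right x).pow_const 2).aestronglyMeasurable

/-! ### A Gaussian vector and a fixed subspace -/

/-- The standard Gaussian measure on `ℝᵐ`. -/
noncomputable abbrev stdGaussianPi (m : ℕ) : Measure (Fin m → ℝ) :=
  Measure.pi fun _ : Fin m => gaussianReal 0 1

lemma hasGaussianLaw_stdGaussianPi (m : ℕ) :
    HasGaussianLaw (fun g : Fin m → ℝ => fun j => g j) (stdGaussianPi m) := by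
  refine iIndepFun.hasGaussianLaw (X := fun j (g : Fin m → ℝ) => g j) (fun j => ?_)
    (iIndepFun_pi (X := fun (_ : Fin m) (x : ℝ) => x) fun i => aemeasurable_id)
  constructor
  rw [(measurePreserving_eval (fun _ : Fin m => gaussianReal 0 1) j).map_eq]
  infer_instance

lemma memLp_eval_stdGaussianPi {m : ℕ} (j : Fin m) :
    MemLp (fun g : Fin m → ℝ => g j) 2 (stdGaussianPi m) :=
  isStandardSubgaussian_gaussianReal.memLp_id.comp_measurePreserving
    (measurePreserving_eval (fun _ : Fin m => gaussianReal 0 1) j)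

lemma covariance_eval_stdGaussianPi {m : ℕ} (i j : Fin m) :
    cov[fun g : Fin m → ℝ => g i, fun g => g j; stdGaussianPi m] = if i = j then 1 else 0 := by
  split_ifs with h
  · subst h
    rw [covariance_self (measurable_pi_apply i).aemeasurable,
      ((measurePreserving_eval (fun _ : Fin m => gaussianReal 0 1) i).hasLaw).variance_eq,
      variance_id_gaussianReal]
    simp
  · exact ((iIndepFun_pi (μ := fun _ : Fin m => gaussianReal 0 1)
      (X := fun (_ : Fin m) (x : ℝ) => x) fun i => aemeasurable_id).indepFun h).covariance_eq_zero
      (memLp_eval_stdGaussianPi i) (memLp_eval_stdGaussianPi j)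

lemma covariance_dotProduct_stdGaussianPi {m : ℕ} (u v : Fin m → ℝ) :
    cov[fun g => u ⬝ᵥ g, fun g => v ⬝ᵥ g; stdGaussianPi m] = u ⬝ᵥ v := by
  simp only [dotProduct]
  rw [covariance_fun_sum_fun_sum (fun j => (memLp_eval_stdGaussianPi j).const_mul _)
    (fun j => (memLp_eval_stdGaussianPi j).const_mul _)]
  simp only [covariance_const_mul_left, covariance_const_mul_right, covariance_eval_stdGaussianPi]
  simp [mul_comm]

/-- The coordinates of a standard Gaussian vector along orthonormal directions are independent. -/
lemma iIndepFun_dotProduct_stdGaussianPi {k m : ℕ} {Q : Matrix (Fin k) (Fin m) ℝ}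
    (hQ : Q * Qᵀ = 1) : iIndepFun (fun i g => Q i ⬝ᵥ g) (stdGaussianPi m) := by
  refine HasGaussianLaw.iIndepFun_of_covariance_eq_zero ?_ fun i j hij => ?_
  · exact (hasGaussianLaw_stdGaussianPi m).map (LinearMap.toContinuousLinearMap Q.mulVecLin)
  · rw [covariance_dotProduct_stdGaussianPi]
    have := congrFun (congrFun hQ i) j
    rwa [Matrix.one_apply_ne hij] at this

lemma dotProduct_row_self {k m : ℕ} {Q : Matrix (Fin k) (Fin m) ℝ} (hQ : Q * Qᵀ = 1)
    (i : Fin k) : Q i ⬝ᵥ Q i = 1 := by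
  have := congrFun (congrFun hQ i) i
  rwa [Matrix.one_apply_eq] at this

lemma le_of_mul_transpose_eq_one {k m : ℕ} {Q : Matrix (Fin k) (Fin m) ℝ} (hQ : Q * Qᵀ = 1) :
    k ≤ m := by
  have h1 := Matrix.rank_mul_le_left Q Qᵀ
  rw [hQ, Matrix.rank_one, Fintype.card_fin] at h1
  simpa using h1.trans (Matrix.rank_le_width Q)

/-- The ratio `(m / k) |Q g|² / |g|²` concentrates around one for a Gaussian vector `g` and a
matrix `Q` with orthonormal rows. -/
lemma exists_stdGaussianPi_distortion_le :
    ∃ C > (0 : ℝ), ∀ {k m : ℕ} (Q : Matrix (Fin k) (Fin m) ℝ), 0 < k → Q * Qᵀ = 1 →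
      ∀ ε : ℝ, 0 < ε → ε ≤ 1 →
        (stdGaussianPi m).real {g | ε * (g ⬝ᵥ g) ≤ |m / k * (g ⬝ᵥ ((Qᵀ * Q) *ᵥ g)) - g ⬝ᵥ g|} ≤
          4 * Real.exp (-C * ε ^ 2 * k) := by
  obtain ⟨C, hC, h⟩ := exists_measure_sum_sq_le
  refine ⟨C / 16, by positivity, ?_⟩
  intro k m Q hk hQ ε hε hε1
  have hkm := le_of_mul_transpose_eq_one hQ
  have hk' : (0 : ℝ) < k := Nat.cast_pos.2 hk
  have hm' : (0 : ℝ) < m := Nat.cast_pos.2 (hk.trans_le hkm)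
  have hkm' : (k : ℝ) ≤ m := Nat.cast_le.2 hkm
  -- Applied to `Q` and to the identity, this shows that both `|Q g|² / k` and `|g|² / m` are within
  -- `ε / 4` of one, outside two exceptional events.
  have conc : ∀ {l : ℕ} (V : Matrix (Fin l) (Fin m) ℝ), V * Vᵀ = 1 →
      (stdGaussianPi m).real {g | l * (ε / 4) ≤ |∑ i, (V i ⬝ᵥ g) ^ 2 - l|} ≤
        2 * Real.exp (-C * (ε / 4) ^ 2 * l) := fun V hV =>
    h (stdGaussianPi m) _ (fun i g => V i ⬝ᵥ g) (fun i => measurable_dotProduct_right _)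
      (iIndepFun_dotProduct_stdGaussianPi hV)
      (fun i => isStandardSubgaussian_gaussianReal.hasSubgaussianMGF_dotProduct
        (dotProduct_row_self hV i))
      (fun i => isStandardSubgaussian_gaussianReal.integral_dotProduct_sq
        (dotProduct_row_self hV i)) (ε / 4) (by positivity) (by linarith)
  have h1 := conc Q hQ
  have h2 := conc (1 : Matrix (Fin m) (Fin m) ℝ) (by simp)
  have hexp : Real.exp (-C * (ε / 4) ^ 2 * m) ≤ Real.exp (-C * (ε / 4) ^ 2 * k) := by
    refine Real.exp_le_exp.2 ?_
    have : 0 ≤ C * (ε / 4) ^ 2 := by positivity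
    nlinarith
  have hquad : ∀ g, g ⬝ᵥ ((Qᵀ * Q) *ᵥ g) = ∑ i, (Q i ⬝ᵥ g) ^ 2 := by
    intro g
    rw [← Matrix.mulVec_mulVec, Matrix.dotProduct_mulVec, Matrix.vecMul_transpose]
    simp only [dotProduct, Matrix.mulVec, sq]
  have hnorm : ∀ g : Fin m → ℝ, g ⬝ᵥ g = ∑ i, ((1 : Matrix (Fin m) (Fin m) ℝ) i ⬝ᵥ g) ^ 2 := by
    intro g
    have : ∀ i, (1 : Matrix (Fin m) (Fin m) ℝ) i ⬝ᵥ g = g i := fun i =>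
      congrFun (Matrix.one_mulVec g) i
    simp only [this, sq]
    rfl
  calc _ ≤ (stdGaussianPi m).real
        ({g | k * (ε / 4) ≤ |∑ i, (Q i ⬝ᵥ g) ^ 2 - k|} ∪
          {g | m * (ε / 4) ≤ |∑ i, ((1 : Matrix (Fin m) (Fin m) ℝ) i ⬝ᵥ g) ^ 2 - m|}) := by
        refine measureReal_mono fun g hg => ?_
        simp only [Set.mem_ofPred_eq, Set.mem_union] at hg ⊢
        rw [hquad] at hg
        rw [← hnorm]
        by_contra! hcon
        obtain ⟨ha, hb⟩ := hcon
        set a := ∑ i, (Q i ⬝ᵥ g) ^ 2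
        set b := g ⬝ᵥ g
        rw [abs_lt] at ha hb
        -- Both `m / k * a` and `b` lie within `m ε / 4` of `m`, so they differ by less than `m ε /
        -- 2`. This is at most `ε m (1 - ε / 4) < ε b`, because `ε ≤ 1`.
        have e : |m / k * a - b| < ε * b := by
          have ha1 : m / k * a < m * (1 + ε / 4) := by
            rw [div_mul_eq_mul_div, div_lt_iff₀ hk']
            nlinarith
          have ha2 : m * (1 - ε / 4) < m / k * a := by
            rw [div_mul_eq_mul_div, lt_div_iff₀ hk']
            nlinarith
          have hb3 : ε * (m * (1 - ε / 4)) < ε * b := by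
            refine mul_lt_mul_of_pos_left ?_ hε
            nlinarith
          have hb4 : m * (ε / 2) ≤ ε * (m * (1 - ε / 4)) := by
            have : 0 < m * ε := by positivity
            nlinarith
          rw [abs_lt]
          constructor <;> nlinarith
        linarith
    _ ≤ _ := measureReal_union_le _ _
    _ ≤ 2 * Real.exp (-C * (ε / 4) ^ 2 * k) + 2 * Real.exp (-C * (ε / 4) ^ 2 * m) :=
        add_le_add h1 h2
    _ ≤ 4 * Real.exp (-C * (ε / 4) ^ 2 * k) := by linarith
    _ = _ := by congr 2; ring

/-! ### Norm distortion for a random subspace -/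

/-- Some orthogonal matrix maps `x` to `y` if these vectors have the same norm. -/
lemma exists_mem_orthogonalGroup_mulVec_eq {m : ℕ} (x y : Fin m → ℝ) (h : x ⬝ᵥ x = y ⬝ᵥ y) :
    ∃ R ∈ Matrix.orthogonalGroup (Fin m) ℝ, Rᵀ *ᵥ x = y := by
  by_cases hw : x - y = 0
  · exact ⟨1, one_mem _, by rw [Matrix.transpose_one, Matrix.one_mulVec, sub_eq_zero.1 hw]⟩
  set w := x - y with hw_def
  have hww : w ⬝ᵥ w ≠ 0 := fun h0 => hw (dotProduct_self_eq_zero.1 h0)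
  -- The witness is the Householder reflection in the hyperplane orthogonal to `x - y`.
  have hsym : (1 - (2 / (w ⬝ᵥ w)) • Matrix.vecMulVec w w)ᵀ =
      1 - (2 / (w ⬝ᵥ w)) • Matrix.vecMulVec w w := by
    rw [Matrix.transpose_sub, Matrix.transpose_one, Matrix.transpose_smul,
      Matrix.transpose_vecMulVec]
  refine ⟨1 - (2 / (w ⬝ᵥ w)) • Matrix.vecMulVec w w, ?_, ?_⟩
  · rw [Matrix.mem_orthogonalGroup_iff, hsym, sub_mul, mul_sub, mul_sub, one_mul,
      mul_one, one_mul, smul_mul_smul_comm, Matrix.vecMulVec_mul_vecMulVec, Matrix.vecMulVec_smul,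
      smul_smul]
    have : 2 / (w ⬝ᵥ w) * (2 / (w ⬝ᵥ w)) * (w ⬝ᵥ w) = 2 / (w ⬝ᵥ w) + 2 / (w ⬝ᵥ w) := by
      field_simp; norm_num
    rw [this, add_smul]
    abel
  · have hwx : w ⬝ᵥ w = 2 * (w ⬝ᵥ x) := by
      simp only [hw_def, sub_dotProduct, dotProduct_sub, dotProduct_comm y x]
      linarith
    rw [hsym, Matrix.sub_mulVec, Matrix.one_mulVec, Matrix.smul_mulVec, Matrix.vecMulVec_mulVec]
    have hwx0 : w ⬝ᵥ x ≠ 0 := fun h0 => hww (by rw [hwx, h0, mul_zero])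
    ext i
    simp only [Pi.sub_apply, Pi.smul_apply, smul_eq_mul, MulOpposite.smul_eq_mul_unop,
      MulOpposite.unop_op]
    rw [hwx]
    have : 2 / (2 * (w ⬝ᵥ x)) * (w i * (w ⬝ᵥ x)) = w i := by field_simp
    rw [this, hw_def, Pi.sub_apply]
    ring

/-- The matrices, given by their entries, whose quadratic form multiplied by `r` distorts the
squared norm of `x` by the relative amount `ε` at least. -/
def distortionSet {m : ℕ} (r ε : ℝ) (x : Fin m → ℝ) : Set (Fin m × Fin m → ℝ) :=
  {M | ε * (x ⬝ᵥ x) ≤ |r * ∑ i, ∑ j, x i * M (i, j) * x j - x ⬝ᵥ x|}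

lemma sum_sum_eq_dotProduct_mulVec {m : ℕ} (M : Matrix (Fin m) (Fin m) ℝ) (x : Fin m → ℝ) :
    ∑ i, ∑ j, x i * M i j * x j = x ⬝ᵥ (M *ᵥ x) := by
  simp only [dotProduct, Matrix.mulVec, Finset.mul_sum, mul_assoc]

lemma mem_distortionSet_iff {m : ℕ} {r ε : ℝ} {x : Fin m → ℝ} {M : Matrix (Fin m) (Fin m) ℝ} :
    (fun p : Fin m × Fin m => M p.1 p.2) ∈ distortionSet r ε x ↔
      ε * (x ⬝ᵥ x) ≤ |r * (x ⬝ᵥ (M *ᵥ x)) - x ⬝ᵥ x| := by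
  rw [← sum_sum_eq_dotProduct_mulVec]
  rfl

lemma measurableSet_distortionSet_prod {m : ℕ} (r ε : ℝ) :
    MeasurableSet {q : (Fin m × Fin m → ℝ) × (Fin m → ℝ) | q.1 ∈ distortionSet r ε q.2} := by
  simp only [distortionSet, dotProduct, Set.mem_ofPred_eq]
  exact measurableSet_le (by fun_prop) (by fun_prop)

lemma measurableSet_distortionSet {m : ℕ} (r ε : ℝ) (x : Fin m → ℝ) :
    MeasurableSet (distortionSet r ε x) :=
  measurable_prodMk_right (measurableSet_distortionSet_prod r ε)

lemma distortionSet_smul {m : ℕ} (r ε : ℝ) (x : Fin m → ℝ) {t : ℝ} (ht : t ≠ 0) :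
    distortionSet r ε (t • x) = distortionSet r ε x := by
  ext M
  have ht2 : 0 < t ^ 2 := by positivity
  have e : ∑ i, ∑ j, (t • x) i * M (i, j) * (t • x) j = t ^ 2 * ∑ i, ∑ j, x i * M (i, j) * x j := by
    simp only [Finset.mul_sum, Pi.smul_apply, smul_eq_mul]
    refine Finset.sum_congr rfl fun i _ => Finset.sum_congr rfl fun j _ => by ring
  simp only [distortionSet, Set.mem_ofPred_eq, e, dotProduct_smul, smul_dotProduct, smul_eq_mul]
  rw [show ∀ a b : ℝ, r * (t ^ 2 * a) - t * (t * b) = t ^ 2 * (r * a - b) by intros; ring,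
    abs_mul, abs_of_pos ht2, show ∀ b : ℝ, ε * (t * (t * b)) = t ^ 2 * (ε * b) by intros; ring,
    mul_le_mul_iff_right₀ ht2]

section RandomSubspace

variable {Ω : Type*} [MeasurableSpace Ω] {μ : Measure Ω} {k m : ℕ}
  {Q : Ω → Matrix (Fin k) (Fin m) ℝ}

lemma IsRandomSubspaceProjection.aemeasurable (hQ : IsRandomSubspaceProjection Q μ) :
    AEMeasurable (fun ω (p : Fin m × Fin m) => ((Q ω)ᵀ * Q ω) p.1 p.2) μ := by
  refine aemeasurable_pi_lambda _ fun p => ?_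
  simp only [Matrix.mul_apply, Matrix.transpose_apply]
  exact Finset.aemeasurable_fun_sum _ fun i _ => (hQ.1 _ _).mul (hQ.1 _ _)

/-- Conjugating the projection by an orthogonal matrix that carries `x` to `y` turns the quadratic
form at `x` into the one at `y`, and leaves the law unchanged. -/
lemma IsRandomSubspaceProjection.map_distortionSet_eq (hQ : IsRandomSubspaceProjection Q μ)
    (r ε : ℝ) {x y : Fin m → ℝ} (hxy : x ⬝ᵥ x = y ⬝ᵥ y) :
    (μ.map fun ω (p : Fin m × Fin m) => ((Q ω)ᵀ * Q ω) p.1 p.2) (distortionSet r ε x) =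
      (μ.map fun ω (p : Fin m × Fin m) => ((Q ω)ᵀ * Q ω) p.1 p.2) (distortionSet r ε y) := by
  obtain ⟨R, hR, hRx⟩ := exists_mem_orthogonalGroup_mulVec_eq x y hxy
  have hid := hQ.2.2 R hR
  refine (congrArg (fun ρ => ρ (distortionSet r ε x)) hid.map_eq.symm).trans ?_
  rw [Measure.map_apply_of_aemeasurable hid.aemeasurable_fst
    (measurableSet_distortionSet r ε x), Measure.map_apply_of_aemeasurable hQ.aemeasurable
    (measurableSet_distortionSet r ε y)]
  congr 1
  ext ω
  simp only [Set.mem_preimage, mem_distortionSet_iff]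
  rw [hxy, ← Matrix.mulVec_mulVec, hRx, ← Matrix.mulVec_mulVec, Matrix.dotProduct_mulVec,
    ← Matrix.mulVec_transpose, hRx]

end RandomSubspace

/-- The distortion probability is the same for all directions, hence equals its average over an
independent Gaussian direction. Fubini's theorem allows the subspace to be fixed first. -/
lemma exists_measure_norm_distortion_le_of_isRandomSubspaceProjection :
    ∃ C > (0 : ℝ), ∀ {Ω : Type*} [MeasurableSpace Ω] (μ : Measure Ω) [IsProbabilityMeasure μ]
      {k m : ℕ} (Q : Ω → Matrix (Fin k) (Fin m) ℝ), IsRandomSubspaceProjection Q μ →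
      ∀ x : Fin m → ℝ, x ⬝ᵥ x = 1 → ∀ ε : ℝ, 0 < ε → ε ≤ 1 →
        μ.real {ω | ε ≤ |m / k * ((Q ω *ᵥ x) ⬝ᵥ (Q ω *ᵥ x)) - 1|} ≤
          4 * Real.exp (-C * ε ^ 2 * k) := by
  obtain ⟨C, hC, h⟩ := exists_stdGaussianPi_distortion_le
  refine ⟨C, hC, ?_⟩
  intro Ω _ μ _ k m Q hQ x hx ε hε hε1
  rcases Nat.eq_zero_or_pos k with rfl | hk
  · simp only [Nat.cast_zero, mul_zero, Real.exp_zero]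
    exact measureReal_le_one.trans (by norm_num)
  set P : Ω → Fin m × Fin m → ℝ := fun ω p => ((Q ω)ᵀ * Q ω) p.1 p.2 with hP
  have hPm : AEMeasurable P μ := hQ.aemeasurable
  have : IsProbabilityMeasure (μ.map P) := Measure.isProbabilityMeasure_map hPm
  set r : ℝ := m / k
  have hset : {ω | ε ≤ |r * ((Q ω *ᵥ x) ⬝ᵥ (Q ω *ᵥ x)) - 1|} = P ⁻¹' distortionSet r ε x := by
    ext ω
    simp only [Set.mem_preimage, hP, mem_distortionSet_iff, Set.mem_ofPred_eq, hx, mul_one]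
    rw [← Matrix.mulVec_mulVec, Matrix.dotProduct_mulVec x, Matrix.vecMul_transpose]
  set S := {q : (Fin m × Fin m → ℝ) × (Fin m → ℝ) | q.1 ∈ distortionSet r ε q.2} with hS
  have hSm : MeasurableSet S := measurableSet_distortionSet_prod r ε
  have hlow : (μ.map P) (distortionSet r ε x) ≤ ((μ.map P).prod (stdGaussianPi m)) S := by
    rw [Measure.prod_apply_symm hSm]
    calc (μ.map P) (distortionSet r ε x)
        = ∫⁻ _g, (μ.map P) (distortionSet r ε x) ∂(stdGaussianPi m) := by simp
      _ ≤ _ := by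
        refine lintegral_mono fun g => ?_
        change _ ≤ (μ.map P) (distortionSet r ε g)
        -- At `g = 0` the defining inequality reads `0 ≤ 0`, so the distortion set is everything.
        -- Hence only an inequality is claimed.
        by_cases hg : g = 0
        · refine measure_mono fun M _ => ?_
          simp [distortionSet, hg]
        · have hgg : 0 < g ⬝ᵥ g :=
            lt_of_le_of_ne (Finset.sum_nonneg fun i _ => mul_self_nonneg (g i)) fun h0 => hg (dotProduct_self_eq_zero.1 h0.symm)
          have hs : √(g ⬝ᵥ g) ≠ 0 := (Real.sqrt_pos.2 hgg).ne'
          rw [← distortionSet_smul r ε x hs]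
          refine (hQ.map_distortionSet_eq r ε ?_).le
          rw [dotProduct_smul, smul_dotProduct, hx, smul_eq_mul, smul_eq_mul, mul_one,
            Real.mul_self_sqrt hgg.le]
  have hsec : ∀ ω, Prod.mk (P ω) ⁻¹' S =
      {g | ε * (g ⬝ᵥ g) ≤ |m / k * (g ⬝ᵥ (((Q ω)ᵀ * Q ω) *ᵥ g)) - g ⬝ᵥ g|} := fun ω => by
    ext g
    rw [hS, Set.mem_preimage, Set.mem_ofPred_eq, Set.mem_ofPred_eq, hP, mem_distortionSet_iff]
  have hup : ((μ.map P).prod (stdGaussianPi m)) S ≤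
      ENNReal.ofReal (4 * Real.exp (-C * ε ^ 2 * k)) := by
    have hSm' : Measurable fun M => (stdGaussianPi m) (Prod.mk M ⁻¹' S) :=
      measurable_measure_prodMk_left hSm
    rw [Measure.prod_apply hSm]
    refine (lintegral_map' hSm'.aemeasurable hPm).trans_le ?_
    calc ∫⁻ ω, (stdGaussianPi m) (Prod.mk (P ω) ⁻¹' S) ∂μ
        ≤ ∫⁻ _ω, ENNReal.ofReal (4 * Real.exp (-C * ε ^ 2 * k)) ∂μ := by
          refine lintegral_mono_ae ?_
          filter_upwards [hQ.2.1] with ω hω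
          rw [hsec ω, ← ofReal_measureReal]
          exact ENNReal.ofReal_le_ofReal (h (Q ω) hk hω ε hε hε1)
      _ = _ := by rw [lintegral_const, measure_univ, mul_one]
  rw [hset, measureReal_def, ← Measure.map_apply_of_aemeasurable hPm
    (measurableSet_distortionSet r ε x)]
  exact ENNReal.toReal_le_of_le_ofReal (by positivity) (hlow.trans hup)

/-! ### The Johnson–Lindenstrauss property for all projectors -/

lemma IsRandomProjector.norm_distortion_cases {Ω : Type*} [MeasurableSpace Ω] {k m : ℕ}
    {T : Ω → Matrix (Fin k) (Fin m) ℝ} {μ : Measure Ω} (hT : IsRandomProjector T μ) :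
    (∃ Q : Ω → Matrix (Fin k) (Fin m) ℝ, IsRandomSubspaceProjection Q μ ∧
      ∀ ω x, (T ω *ᵥ x) ⬝ᵥ (T ω *ᵥ x) = m / k * ((Q ω *ᵥ x) ⬝ᵥ (Q ω *ᵥ x))) ∨
    ∃ U ν, IsStandardSubgaussian ν ∧ HasIIDEntries U ν μ ∧ ∀ ω, T ω = (1 / √(k : ℝ)) • U ω := by
  obtain ⟨U, hTU, ⟨Q, hQ, hUQ⟩ | hU | hU | hU⟩ := hT
  · refine Or.inl ⟨Q, hQ, fun ω x => ?_⟩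
    rw [hTU, hUQ, smul_smul, Matrix.smul_mulVec, dotProduct_smul, smul_dotProduct, smul_smul,
      smul_eq_mul]
    congr 1
    rw [mul_mul_mul_comm, ← sq, ← sq, div_pow, Real.sq_sqrt (Nat.cast_nonneg _),
      Real.sq_sqrt (Nat.cast_nonneg _)]
    ring
  · exact Or.inr ⟨U, _, isStandardSubgaussian_gaussianReal, hU, hTU⟩
  · exact Or.inr ⟨U, _, isStandardSubgaussian_signLaw, hU, hTU⟩
  · exact Or.inr ⟨U, _, isStandardSubgaussian_sparseSignLaw, hU, hTU⟩

/-- The Johnson–Lindenstrauss property of a random projector, for a unit vector. -/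
lemma exists_measure_norm_distortion_le_of_unit :
    ∃ C > (0 : ℝ), ∀ {Ω : Type*} [MeasurableSpace Ω] (μ : Measure Ω) [IsProbabilityMeasure μ]
      {k m : ℕ} (T : Ω → Matrix (Fin k) (Fin m) ℝ), IsRandomProjector T μ →
      ∀ x : Fin m → ℝ, x ⬝ᵥ x = 1 → ∀ ε : ℝ, 0 < ε → ε ≤ 1 →
        μ.real {ω | ε ≤ |(T ω *ᵥ x) ⬝ᵥ (T ω *ᵥ x) - 1|} ≤ 4 * Real.exp (-C * ε ^ 2 * k) := by
  obtain ⟨C₁, hC₁, h₁⟩ := exists_measure_norm_distortion_le_of_isRandomSubspaceProjection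
  obtain ⟨C₂, hC₂, h₂⟩ := exists_measure_norm_distortion_le_of_iid
  refine ⟨min C₁ C₂, lt_min hC₁ hC₂, ?_⟩
  intro Ω _ μ _ k m T hT x hx ε hε hε1
  have hs : 0 ≤ ε ^ 2 * k := by positivity
  have he : ∀ C, min C₁ C₂ ≤ C →
      Real.exp (-C * ε ^ 2 * k) ≤ Real.exp (-(min C₁ C₂) * ε ^ 2 * k) := by
    intro C hC
    refine Real.exp_le_exp.2 ?_
    nlinarith
  obtain ⟨Q, hQ, hTQ⟩ | ⟨U, ν, hν, hU, hTU⟩ := hT.norm_distortion_cases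
  · simp only [hTQ]
    exact (h₁ μ Q hQ x hx ε hε hε1).trans (by linarith [he C₁ (min_le_left _ _)])
  · simp only [hTU]
    refine (h₂ μ U ν hν hU x hx ε hε hε1).trans ?_
    linarith [he C₂ (min_le_right _ _), Real.exp_pos (-C₂ * ε ^ 2 * k)]

/-- The Johnson–Lindenstrauss property of a random projector. -/
lemma exists_measure_norm_distortion_le :
    ∃ C > (0 : ℝ), ∀ {Ω : Type*} [MeasurableSpace Ω] (μ : Measure Ω) [IsProbabilityMeasure μ]
      {k m : ℕ} (T : Ω → Matrix (Fin k) (Fin m) ℝ), IsRandomProjector T μ →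
      ∀ (x : Fin m → ℝ) (ε : ℝ), 0 < ε → ε ≤ 1 →
        μ.real {ω | ε * (x ⬝ᵥ x) < |(T ω *ᵥ x) ⬝ᵥ (T ω *ᵥ x) - x ⬝ᵥ x|} ≤
          4 * Real.exp (-C * ε ^ 2 * k) := by
  obtain ⟨C, hC, h⟩ := exists_measure_norm_distortion_le_of_unit
  refine ⟨C, hC, ?_⟩
  intro Ω _ μ _ k m T hT x ε hε hε1
  -- The strict inequality makes the event empty at `x = 0`. This case must be allowed, since the
  -- vectors `u ± w i` used later may vanish.
  by_cases hx : x = 0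
  · simp only [hx, Matrix.mulVec_zero, dotProduct_zero, mul_zero, sub_zero, abs_zero, lt_irrefl,
      Set.ofPred_false, measureReal_empty]
    positivity
  have hxx : 0 < x ⬝ᵥ x :=
    lt_of_le_of_ne (Finset.sum_nonneg fun i _ => mul_self_nonneg (x i))
      fun h0 => hx (dotProduct_self_eq_zero.1 h0.symm)
  set s := √(x ⬝ᵥ x)
  have hs : 0 < s := Real.sqrt_pos.2 hxx
  have hss : s * s = x ⬝ᵥ x := Real.mul_self_sqrt hxx.le
  refine le_trans (measureReal_mono fun ω hω => ?_) (h μ T hT (s⁻¹ • x) ?_ ε hε hε1)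
  · simp only [Set.mem_ofPred_eq, Matrix.mulVec_smul, dotProduct_smul, smul_dotProduct,
      smul_eq_mul] at hω ⊢
    rw [← mul_assoc, ← mul_inv, hss, inv_mul_eq_div, div_sub_one hxx.ne', abs_div,
      abs_of_pos hxx, le_div_iff₀ hxx]
    exact hω.le
  · rw [dotProduct_smul, smul_dotProduct, smul_eq_mul, smul_eq_mul, ← hss]
    field_simp

/-! ### Strong duality and the projected program -/

/-- The image of a closed cone under a linear map is closed if the cone meets the kernel only in
the origin. -/
lemma isClosed_image_of_cone {E F : Type*} [NormedAddCommGroup E] [NormedSpace ℝ E]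
    [FiniteDimensional ℝ E] [NormedAddCommGroup F] [NormedSpace ℝ F] (L : E →L[ℝ] F) {K : Set E}
    (hK : IsClosed K) (hsmul : ∀ x ∈ K, ∀ t : ℝ, 0 ≤ t → t • x ∈ K)
    (hker : ∀ x ∈ K, L x = 0 → x = 0) : IsClosed (L '' K) := by
  have : ProperSpace E := FiniteDimensional.proper_real E
  -- Compactness of the unit sphere makes `L` bounded below on the cone, so preimages of a
  -- convergent sequence stay bounded.
  obtain ⟨κ, hκ, hle⟩ : ∃ κ > (0 : ℝ), ∀ x ∈ K, κ * ‖x‖ ≤ ‖L x‖ := by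
    have hcomp : IsCompact (K ∩ Metric.sphere (0 : E) 1) := (isCompact_sphere 0 1).inter_left hK
    obtain ⟨κ, hκ, hmin⟩ : ∃ κ > (0 : ℝ), ∀ x ∈ K ∩ Metric.sphere (0 : E) 1, κ ≤ ‖L x‖ := by
      refine (Set.eq_empty_or_nonempty (K ∩ Metric.sphere (0 : E) 1)).elim
        (fun h => ⟨1, one_pos, by simp [h]⟩) fun h => ?_
      obtain ⟨x₀, hx₀, hx₀min⟩ := hcomp.exists_isMinOn h (f := fun x => ‖L x‖) (by fun_prop)
      refine ⟨‖L x₀‖, norm_pos_iff.2 fun h0 => ?_, fun x hx => hx₀min hx⟩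
      have h1 := hx₀.2
      rw [hker x₀ hx₀.1 h0] at h1
      simp at h1
    refine ⟨κ, hκ, fun x hx => ?_⟩
    by_cases h0 : x = 0
    · simp [h0]
    have hn : 0 < ‖x‖ := norm_pos_iff.2 h0
    have h1 := hmin (‖x‖⁻¹ • x) ⟨hsmul x hx _ (by positivity), by
      rw [mem_sphere_zero_iff_norm, norm_smul, norm_inv, norm_norm, inv_mul_cancel₀ hn.ne']⟩
    rwa [map_smul, norm_smul, norm_inv, norm_norm, inv_mul_eq_div, le_div_iff₀ hn] at h1
  refine IsSeqClosed.isClosed fun y y₀ hy hlim => ?_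
  choose x hxK hxy using hy
  obtain ⟨M, hM⟩ := (Metric.isBounded_range_of_tendsto y hlim).exists_norm_le
  have hbdd : ∀ i, x i ∈ Metric.closedBall (0 : E) (M / κ) := by
    intro i
    rw [mem_closedBall_zero_iff, le_div_iff₀ hκ, mul_comm]
    exact (hle _ (hxK i)).trans (hxy i ▸ hM _ ⟨i, rfl⟩)
  obtain ⟨x₀, -, φ, hφ, hφlim⟩ := (isCompact_closedBall (0 : E) (M / κ)).tendsto_subseq hbdd
  refine ⟨x₀, hK.mem_of_tendsto hφlim (Filter.Eventually.of_forall fun i => hxK _), ?_⟩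
  refine tendsto_nhds_unique ((L.continuous.tendsto x₀).comp hφlim) ?_
  have : (L ∘ x ∘ φ) = y ∘ φ := funext fun i => hxy (φ i)
  rw [this]
  exact hlim.comp hφ.tendsto_atTop

section LinearProgram

variable {m n : ℕ} {A : Matrix (Fin m) (Fin n) ℝ} {b : Fin m → ℝ} {c : Fin n → ℝ}

/-- A nonzero such `x` would be a recession direction: from any feasible point, a long enough step
along it leaves every ball. -/
lemma eq_zero_of_isBounded_primalFeasible (hne : (primalFeasible A b).Nonempty)
    (hbd : Bornology.IsBounded (primalFeasible A b)) {x : Fin n → ℝ} (hx : ∀ j, 0 ≤ x j)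
    (hAx : A *ᵥ x = 0) : x = 0 := by
  obtain ⟨z, hz⟩ := hne
  obtain ⟨M, hM⟩ := hbd.exists_norm_le
  by_contra h0
  have hn : 0 < ‖x‖ := norm_pos_iff.2 h0
  have hM0 : 0 ≤ M := (norm_nonneg z).trans (hM z hz)
  set t := (M + ‖z‖ + 1) / ‖x‖
  have ht : 0 ≤ t := by positivity
  have h1 : z + t • x ∈ primalFeasible A b := by
    refine ⟨by rw [Matrix.mulVec_add, Matrix.mulVec_smul, hAx, hz.1, smul_zero, add_zero],
      fun j => ?_⟩
    exact add_nonneg (hz.2 j) (mul_nonneg ht (hx j))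
  have h2 : ‖t • x‖ ≤ ‖z + t • x‖ + ‖z‖ := by
    simpa using norm_sub_le (z + t • x) z
  rw [norm_smul, Real.norm_of_nonneg ht, div_mul_cancel₀ _ hn.ne'] at h2
  linarith [hM _ h1]

/-- Dual feasible points come arbitrarily close to the primal optimal value: separate `(b, t)` from
the closed cone of the vectors `(A x, c ⬝ᵥ x + s)` for `x ≥ 0` and `s ≥ 0`. -/
lemma exists_dualFeasible_gt (hne : (primalFeasible A b).Nonempty)
    (hbd : Bornology.IsBounded (primalFeasible A b)) {x : Fin n → ℝ}
    (hx : IsOptimalSolution c (primalFeasible A b) x) {t : ℝ} (ht : t < c ⬝ᵥ x) :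
    ∃ z ∈ dualFeasible A c, t < b ⬝ᵥ z := by
  let L : ((Fin n → ℝ) × ℝ) →ₗ[ℝ] ((Fin m → ℝ) × ℝ) :=
    { toFun := fun p => (A *ᵥ p.1, c ⬝ᵥ p.1 + p.2)
      map_add' := fun p q => by
        ext <;> simp [Matrix.mulVec_add, dotProduct_add]
        ring
      map_smul' := fun r p => by
        ext <;> simp [Matrix.mulVec_smul, dotProduct_smul, mul_add] }
  have hL : ∀ p, L p = (A *ᵥ p.1, c ⬝ᵥ p.1 + p.2) := fun p => rfl
  let K : Set ((Fin n → ℝ) × ℝ) := {p | 0 ≤ p.1 ∧ 0 ≤ p.2}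
  have hKc : IsClosed K :=
    (isClosed_le continuous_const continuous_fst).inter
      (isClosed_le continuous_const continuous_snd)
  have hcl : IsClosed (LinearMap.toContinuousLinearMap L '' K) := by
    refine isClosed_image_of_cone _ hKc (fun p hp r hr => ⟨?_, ?_⟩) fun p hp h0 => ?_
    · exact smul_nonneg hr hp.1
    · exact smul_nonneg hr hp.2
    · have h0' : (A *ᵥ p.1, c ⬝ᵥ p.1 + p.2) = 0 := h0
      rw [Prod.mk_eq_zero] at h0'
      have h1 : p.1 = 0 := eq_zero_of_isBounded_primalFeasible hne hbd hp.1 h0'.1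
      have h2 := h0'.2
      rw [h1, dotProduct_zero, zero_add] at h2
      exact Prod.ext h1 h2
  let S : ProperCone ℝ ((Fin m → ℝ) × ℝ) :=
    { carrier := LinearMap.toContinuousLinearMap L '' K
      add_mem' := by
        rintro _ _ ⟨p, hp, rfl⟩ ⟨q, hq, rfl⟩
        exact ⟨p + q, ⟨add_nonneg hp.1 hq.1, add_nonneg hp.2 hq.2⟩, map_add _ _ _⟩
      zero_mem' := ⟨0, ⟨le_rfl, le_rfl⟩, map_zero _⟩
      smul_mem' := by
        rintro r _ ⟨p, hp, rfl⟩
        exact ⟨(r : ℝ) • p, ⟨smul_nonneg r.2 hp.1, smul_nonneg r.2 hp.2⟩, map_smul _ _ _⟩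
      isClosed' := hcl }
  have hmem : ∀ p ∈ K, L p ∈ S := fun p hp => ⟨p, hp, rfl⟩
  have hnot : (b, t) ∉ S := by
    rintro ⟨p, hp, hpe⟩
    have hpe' : (A *ᵥ p.1, c ⬝ᵥ p.1 + p.2) = (b, t) := hpe
    rw [Prod.mk.injEq] at hpe'
    have := hx.2 p.1 ⟨hpe'.1, hp.1⟩
    linarith [hp.2, hpe'.2]
  obtain ⟨f, hf, hfb⟩ := S.hyperplane_separation_point hnot
  set y : Fin m → ℝ := fun i => f (Pi.single i 1, 0)
  set s : ℝ := f (0, 1)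
  have hfr : ∀ w r, f (w, r) = y ⬝ᵥ w + s * r := by
    intro w r
    have e : (w, r) = (∑ i, w i • ((Pi.single i 1 : Fin m → ℝ), (0 : ℝ))) +
        r • ((0 : Fin m → ℝ), (1 : ℝ)) := by
      ext i
      · simp [Prod.fst_sum, Finset.sum_apply, Pi.single_apply]
      · simp [Prod.snd_sum]
    rw [e, map_add, map_sum, map_smul, smul_eq_mul, mul_comm r]
    simp only [map_smul, smul_eq_mul, dotProduct, y, s, mul_comm]
  -- The functional is nonnegative at `(b, c ⬝ᵥ x)`, the image of the optimal solution, and negative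
  -- at `(b, t)`. Hence `s (c ⬝ᵥ x - t) > 0`.
  have hs : 0 < s := by
    have h1 := hf _ (hmem (x, 0) ⟨hx.1.2, le_rfl⟩)
    rw [hL, hx.1.1, hfr] at h1
    rw [hfr] at hfb
    simp only [add_zero] at h1
    by_contra! hcon
    nlinarith
  -- Normalizing the last coefficient to one turns nonnegativity on the generators `(A.col j, c j)`
  -- into dual feasibility.
  refine ⟨-(s⁻¹ • y), fun j => ?_, ?_⟩
  · have h1 := hf _ (hmem (Pi.single j 1, 0) ⟨Pi.single_nonneg.2 zero_le_one, le_rfl⟩)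
    rw [hL, hfr] at h1
    simp only [add_zero, dotProduct_single, mul_one, Matrix.dotProduct_mulVec] at h1
    rw [Matrix.neg_vecMul, Matrix.smul_vecMul, Pi.neg_apply, Pi.smul_apply, smul_eq_mul,
      inv_mul_eq_div, neg_le, le_div_iff₀ hs]
    linarith
  · rw [hfr, dotProduct_comm] at hfb
    rw [dotProduct_neg, dotProduct_smul, smul_eq_mul, inv_mul_eq_div, lt_neg, div_lt_iff₀ hs]
    linarith

lemma weak_duality {x : Fin n → ℝ} (hx : ∀ j, 0 ≤ x j) {y : Fin m → ℝ}
    (hy : y ∈ dualFeasible A c) : y ⬝ᵥ (A *ᵥ x) ≤ c ⬝ᵥ x := by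
  rw [Matrix.dotProduct_mulVec]
  exact Finset.sum_le_sum fun j _ => mul_le_mul_of_nonneg_right (hy j) (hx j)

/-- Strong duality for a linear program with a nonempty and bounded feasible region. -/
lemma strong_duality (hne : (primalFeasible A b).Nonempty)
    (hbd : Bornology.IsBounded (primalFeasible A b)) {x : Fin n → ℝ}
    (hx : IsOptimalSolution c (primalFeasible A b) x) {y : Fin m → ℝ}
    (hy : IsDualOptimal A b c y) : b ⬝ᵥ y = c ⬝ᵥ x := by
  refine le_antisymm ?_ (le_of_forall_lt fun t ht => ?_)
  · have := weak_duality hx.1.2 hy.1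
    rwa [hx.1.1, dotProduct_comm] at this
  · obtain ⟨z, hz, htz⟩ := exists_dualFeasible_gt hne hbd hx ht
    exact htz.trans_le (hy.2 z hz)

lemma IsOptimalSolution.optValue_eq {F : Set (Fin n → ℝ)} {x : Fin n → ℝ}
    (hx : IsOptimalSolution c F x) : optValue c F = c ⬝ᵥ x :=
  IsLeast.csInf_eq ⟨⟨x, hx.1, rfl⟩, by rintro _ ⟨z, hz, rfl⟩; exact hx.2 z hz⟩

/-- A bound for the optimal value of the projected program, from an almost-orthogonality property
of its feasible residuals. -/
lemma optValue_projectedFeasible_bounds {k : ℕ} {T : Matrix (Fin k) (Fin m) ℝ} {θ δ : ℝ}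
    {x : Fin n → ℝ} (hx : IsOptimalSolution c (primalFeasible A b) x) (hθ : ∑ j, x j ≤ θ)
    {y : Fin m → ℝ} (hy : y ∈ dualFeasible A c) (hyx : b ⬝ᵥ y = c ⬝ᵥ x)
    (hres : ∀ z ∈ projectedFeasible T A b θ, -δ ≤ y ⬝ᵥ (A *ᵥ z - b)) :
    optValue c (primalFeasible A b) - δ ≤ optValue c (projectedFeasible T A b θ) ∧
      optValue c (projectedFeasible T A b θ) ≤ optValue c (primalFeasible A b) := by
  rw [hx.optValue_eq]
  have hxT : x ∈ projectedFeasible T A b θ :=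
    ⟨by rw [← Matrix.mulVec_mulVec, hx.1.1], hθ, hx.1.2⟩
  have hlow : ∀ r ∈ (fun z => c ⬝ᵥ z) '' projectedFeasible T A b θ, c ⬝ᵥ x - δ ≤ r := by
    rintro _ ⟨z, hz, rfl⟩
    have h1 := hres z hz
    have h2 := weak_duality hz.2.2 hy
    rw [dotProduct_sub, dotProduct_comm y b, hyx] at h1
    simp only
    linarith
  exact ⟨le_csInf ⟨_, x, hxT, rfl⟩ hlow, csInf_le ⟨_, hlow⟩ ⟨x, hxT, rfl⟩⟩

/-- If `T` preserves the inner products of `y` with the columns of `A` and with `b` up to `e`, then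
`y` is almost orthogonal to the residuals of the projected program. -/
lemma neg_le_dotProduct_residual {k : ℕ} {T : Matrix (Fin k) (Fin m) ℝ} {θ e : ℝ}
    {y : Fin m → ℝ} (hb : |y ⬝ᵥ b - (T *ᵥ y) ⬝ᵥ (T *ᵥ b)| ≤ e)
    (hA : ∀ j, |y ⬝ᵥ A.col j - (T *ᵥ y) ⬝ᵥ (T *ᵥ A.col j)| ≤ e)
    {z : Fin n → ℝ} (hz : z ∈ projectedFeasible T A b θ) :
    -(e * (θ + 1)) ≤ y ⬝ᵥ (A *ᵥ z - b) := by
  obtain ⟨hTz, hθ, hz0⟩ := hz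
  have he : 0 ≤ e := (abs_nonneg _).trans hb
  -- As `T A z = T b`, the difference expands over the columns. They contribute at most `e ∑ z_j ≤ e
  -- θ`, and `b` contributes a further `e`.
  have h1 : y ⬝ᵥ (A *ᵥ z) - (T *ᵥ y) ⬝ᵥ (T *ᵥ b) =
      ∑ j, (y ⬝ᵥ A.col j - (T *ᵥ y) ⬝ᵥ (T *ᵥ A.col j)) * z j := by
    rw [← hTz, Matrix.dotProduct_mulVec, Matrix.dotProduct_mulVec, ← sub_dotProduct]
    simp only [dotProduct]
    refine Finset.sum_congr rfl fun j _ => ?_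
    rfl
  have h2 : -(e * θ) ≤ ∑ j, (y ⬝ᵥ A.col j - (T *ᵥ y) ⬝ᵥ (T *ᵥ A.col j)) * z j := by
    have : ∑ j, -e * z j ≤ ∑ j, (y ⬝ᵥ A.col j - (T *ᵥ y) ⬝ᵥ (T *ᵥ A.col j)) * z j :=
      Finset.sum_le_sum fun j _ => mul_le_mul_of_nonneg_right (abs_le.1 (hA j)).1 (hz0 j)
    rw [← Finset.mul_sum] at this
    nlinarith
  rw [dotProduct_sub]
  linarith [(abs_le.1 hb).2]

end LinearProgram

/-! ### Preservation of inner products -/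

lemma euclNorm_sq {d : ℕ} (v : Fin d → ℝ) : euclNorm v ^ 2 = v ⬝ᵥ v := by
  rw [euclNorm, EuclideanSpace.real_norm_sq_eq]
  simp [dotProduct, sq]

lemma abs_dotProduct_le_one {d : ℕ} {u v : Fin d → ℝ} (hu : u ⬝ᵥ u = 1) (hv : v ⬝ᵥ v = 1) :
    |u ⬝ᵥ v| ≤ 1 := by
  have h1 : 0 ≤ (u + v) ⬝ᵥ (u + v) := Finset.sum_nonneg fun i _ => mul_self_nonneg _
  have h2 : 0 ≤ (u - v) ⬝ᵥ (u - v) := Finset.sum_nonneg fun i _ => mul_self_nonneg _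
  simp only [add_dotProduct, dotProduct_add, sub_dotProduct, dotProduct_sub, hu, hv,
    dotProduct_comm v u] at h1 h2
  rw [abs_le]
  constructor <;> linarith

/-- A linear map preserving the norms of `u ± v` almost preserves the inner product of `u`, `v`. -/
lemma abs_dotProduct_sub_le {k m : ℕ} {T : Matrix (Fin k) (Fin m) ℝ} {u v : Fin m → ℝ}
    (hu : u ⬝ᵥ u = 1) (hv : v ⬝ᵥ v = 1) {ε : ℝ}
    (hadd : |(T *ᵥ (u + v)) ⬝ᵥ (T *ᵥ (u + v)) - (u + v) ⬝ᵥ (u + v)| ≤ ε * ((u + v) ⬝ᵥ (u + v)))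
    (hsub : |(T *ᵥ (u - v)) ⬝ᵥ (T *ᵥ (u - v)) - (u - v) ⬝ᵥ (u - v)| ≤ ε * ((u - v) ⬝ᵥ (u - v))) :
    |u ⬝ᵥ v - (T *ᵥ u) ⬝ᵥ (T *ᵥ v)| ≤ ε := by
  -- Polarization: `|u + v|² + |u - v|² = 4`, so the two errors add up to at most `4 ε`, and the
  -- inner product carries a factor `1 / 4`.
  simp only [Matrix.mulVec_add, Matrix.mulVec_sub, add_dotProduct, dotProduct_add, sub_dotProduct,
    dotProduct_sub, hu, hv, dotProduct_comm v u, dotProduct_comm (T *ᵥ v) (T *ᵥ u)] at hadd hsub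
  rw [abs_le] at *
  constructor <;> nlinarith

/-- With unit data, a feasible point has coordinate sum at least one. -/
lemma one_lt_of_sum_lt {m n : ℕ} {A : Matrix (Fin m) (Fin n) ℝ} {b : Fin m → ℝ}
    {x : Fin n → ℝ} {θ : ℝ} (hb : b ⬝ᵥ b = 1) (hA : ∀ j, A.col j ⬝ᵥ A.col j = 1)
    (hx : x ∈ primalFeasible A b) (hθ : ∑ j, x j < θ) : 1 < θ := by
  refine lt_of_le_of_lt ?_ hθ
  calc (1 : ℝ) = b ⬝ᵥ (A *ᵥ x) := by rw [hx.1, hb]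
    _ = ∑ j, (b ⬝ᵥ A.col j) * x j := by rw [Matrix.dotProduct_mulVec]; rfl
    _ ≤ ∑ j, 1 * x j := Finset.sum_le_sum fun j _ => mul_le_mul_of_nonneg_right
        ((le_abs_self _).trans (abs_dotProduct_le_one hb (hA j))) (hx.2 j)
    _ = ∑ j, x j := by simp

/-- A random projector preserves the inner products of a unit vector `u` with unit vectors `w i`
simultaneously, by the union bound over the vectors `u ± w i`. -/
lemma exists_measure_dotProduct_distortion_le :
    ∃ C > (0 : ℝ), ∀ {Ω : Type*} [MeasurableSpace Ω] (μ : Measure Ω) [IsProbabilityMeasure μ]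
      {k m : ℕ} (T : Ω → Matrix (Fin k) (Fin m) ℝ), IsRandomProjector T μ →
      ∀ {ι : Type} [Fintype ι] (w : ι → Fin m → ℝ) (u : Fin m → ℝ), u ⬝ᵥ u = 1 →
      (∀ i, w i ⬝ᵥ w i = 1) → ∀ ε : ℝ, 0 < ε → ε ≤ 1 →
        μ.real {ω | ∃ i, ε < |u ⬝ᵥ w i - (T ω *ᵥ u) ⬝ᵥ (T ω *ᵥ w i)|} ≤
          8 * Fintype.card ι * Real.exp (-C * ε ^ 2 * k) := by
  obtain ⟨C, hC, h⟩ := exists_measure_norm_distortion_le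
  refine ⟨C, hC, ?_⟩
  intro Ω _ μ _ k m T hT ι _ w u hu hw ε hε hε1
  set bad : (Fin m → ℝ) → Set Ω :=
    fun x => {ω | ε * (x ⬝ᵥ x) < |(T ω *ᵥ x) ⬝ᵥ (T ω *ᵥ x) - x ⬝ᵥ x|} with hbad
  have hb : ∀ x, μ.real (bad x) ≤ 4 * Real.exp (-C * ε ^ 2 * k) := fun x => h μ T hT x ε hε hε1
  calc _ ≤ μ.real (⋃ i, (bad (u + w i) ∪ bad (u - w i))) := by
        refine measureReal_mono fun ω hω => ?_
        obtain ⟨i, hi⟩ := hω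
        rw [Set.mem_iUnion]
        refine ⟨i, ?_⟩
        by_contra hcon
        simp only [hbad, Set.mem_union, Set.mem_ofPred_eq, not_or, not_lt] at hcon
        exact absurd (abs_dotProduct_sub_le hu (hw i) hcon.1 hcon.2) (not_le.2 hi)
    _ ≤ ∑ i, μ.real (bad (u + w i) ∪ bad (u - w i)) := measureReal_iUnion_fintype_le _
    _ ≤ ∑ _i : ι, 8 * Real.exp (-C * ε ^ 2 * k) := by
        refine Finset.sum_le_sum fun i _ => (measureReal_union_le _ _).trans ?_
        linarith [hb (u + w i), hb (u - w i)]
    _ = _ := by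
        rw [Finset.sum_const, Finset.card_univ, nsmul_eq_mul]
        ring

/-- A constant factor in front of an exponential bound is absorbed by halving the exponent. -/
lemma one_sub_le_one_sub_of_half_exponent {n : ℕ} (hn : 1 ≤ n) (s : ℝ) :
    1 - 4 * (n : ℝ) * Real.exp (-s) ≤ 0 ∨
      8 * ((n : ℝ) + 1) * Real.exp (-(2 * s)) ≤ 4 * n * Real.exp (-s) := by
  have hn' : (1 : ℝ) ≤ n := Nat.one_le_cast.2 hn
  have hq := Real.exp_pos (-s)
  rw [show -(2 * s) = -s + -s by ring, Real.exp_add]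
  set q := Real.exp (-s)
  -- If `4 n q < 1`, then `8 (n + 1) q < 2 (n + 1) / n ≤ 4`, so one of the two factors `q` absorbs
  -- the constant.
  by_cases h : 1 ≤ 4 * (n : ℝ) * q
  · exact Or.inl (by linarith)
  · right
    push Not at h
    have h1 : 8 * ((n : ℝ) + 1) * q ≤ 4 := by nlinarith
    have h2 : 8 * ((n : ℝ) + 1) * (q * q) ≤ 4 * q := by
      rw [← mul_assoc]
      exact mul_le_mul_of_nonneg_right h1 hq.le
    nlinarith

end LPProjection

/-! ### The main theorem -/

/-- `C` and `c₀` are universal constants; `c₀` is the one implicit in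
`ε = O(δ / (θ² ‖y*‖))`. -/
theorem theorem4p2 :
    ∃ C > (0 : ℝ), ∃ c₀ > (0 : ℝ),
      ∀ (m n k : ℕ) (A : Matrix (Fin m) (Fin n) ℝ) (b : Fin m → ℝ) (c : Fin n → ℝ)
        (θ δ ε : ℝ) (ystar : Fin m → ℝ),
        LPProjection.euclNorm b = 1 →
        LPProjection.euclNorm c = 1 →
        (∀ j, LPProjection.euclNorm (A.col j) = 1) →
        (LPProjection.primalFeasible A b).Nonempty →
        Bornology.IsBounded (LPProjection.primalFeasible A b) →
        (∃ xstar, LPProjection.IsOptimalSolution c (LPProjection.primalFeasible A b) xstar ∧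
          ∑ j, xstar j < θ) →
        LPProjection.IsMinNormDualOptimal A b c ystar →
        0 < δ →
        δ ≤ |LPProjection.optValue c (LPProjection.primalFeasible A b)| →
        0 < ε →
        ε ≤ c₀ * (δ / (θ ^ 2 * LPProjection.euclNorm ystar)) →
        ∀ (Ω : Type*) [MeasurableSpace Ω] (μ : Measure Ω) [IsProbabilityMeasure μ]
          (T : Ω → Matrix (Fin k) (Fin m) ℝ),
          LPProjection.IsRandomProjector T μ →
          1 - 4 * (n : ℝ) * Real.exp (-C * (ε ^ 2 - ε ^ 3) * (k : ℝ)) ≤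
            μ.real {ω |
              LPProjection.optValue c (LPProjection.primalFeasible A b) - δ ≤
                  LPProjection.optValue c (LPProjection.projectedFeasible (T ω) A b θ) ∧
                LPProjection.optValue c (LPProjection.projectedFeasible (T ω) A b θ) ≤
                  LPProjection.optValue c (LPProjection.primalFeasible A b)} := by
  obtain ⟨C, hC, hJL⟩ := LPProjection.exists_measure_dotProduct_distortion_le
  -- Halving `C` pays for reducing the union-bound factor `8 (n + 1)` to `4 n`. The value `c₀ = 1 /
  -- 2` matches `θ + 1 ≤ 2 θ²`, valid as `θ > 1`.
  refine ⟨C / 2, by positivity, 1 / 2, by norm_num, ?_⟩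
  intro m n k A b c θ δ ε y hb hc hA hne hbd ⟨x, hx, hxθ⟩ hy hδ hδv hε hεle Ω _ μ _ T hT
  have hbb : b ⬝ᵥ b = 1 := by rw [← LPProjection.euclNorm_sq, hb, one_pow]
  have hAA : ∀ j, A.col j ⬝ᵥ A.col j = 1 := fun j => by
    rw [← LPProjection.euclNorm_sq, hA j, one_pow]
  have hn : 1 ≤ n := by
    rcases Nat.eq_zero_or_pos n with rfl | h
    · have h0 := LPProjection.euclNorm_sq c
      rw [hc] at h0
      simp at h0
    · exact h
  have hθ : 1 < θ := LPProjection.one_lt_of_sum_lt hbb hAA hx.1 hxθ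
  have hdual : b ⬝ᵥ y = c ⬝ᵥ x := LPProjection.strong_duality hne hbd hx hy.1
  set N := LPProjection.euclNorm y with hN
  -- If `y* = 0`, division by zero makes the upper bound on `ε` equal to `0`, contradicting `ε > 0`.
  have hN0 : 0 < N := by
    refine lt_of_le_of_ne (norm_nonneg _) fun h0 => ?_
    rw [← h0, mul_zero, div_zero, mul_zero] at hεle
    linarith
  set u := N⁻¹ • y with hu_def
  have hyu : y = N • u := by rw [hu_def, smul_smul, mul_inv_cancel₀ hN0.ne', one_smul]
  have huu : u ⬝ᵥ u = 1 := by
    rw [hu_def, dotProduct_smul, smul_dotProduct, smul_eq_mul, smul_eq_mul,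
      ← LPProjection.euclNorm_sq, ← hN]
    field_simp
  clear_value u
  -- Here `δ ≤ |v(P)| = N |b ⬝ᵥ u| ≤ N`. This forces `ε ≤ 1`, the range of the concentration bounds.
  have hδN : δ ≤ N := by
    rw [hx.optValue_eq, ← hdual, hyu, dotProduct_smul, smul_eq_mul, abs_mul, abs_of_pos hN0] at hδv
    nlinarith [LPProjection.abs_dotProduct_le_one hbb huu]
  have hεδ : ε * N * (2 * θ ^ 2) ≤ δ := by
    have h1 : 1 / 2 * (δ / (θ ^ 2 * N)) * N * (2 * θ ^ 2) = δ := by field_simp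
    rw [← h1]
    gcongr
  have hε1 : ε ≤ 1 := by
    by_contra! hcon
    have h1 : ε * N * 1 ≤ ε * N * (2 * θ ^ 2) :=
      mul_le_mul_of_nonneg_left (by nlinarith) (by positivity)
    nlinarith [mul_lt_mul_of_pos_right hcon hN0]
  set w : Option (Fin n) → Fin m → ℝ := fun i => i.elim b A.col
  have hw : ∀ i, w i ⬝ᵥ w i = 1 := by
    rintro (_ | j)
    exacts [hbb, hAA j]
  have hprob := hJL μ T hT w u huu hw ε hε hε1
  set bad := {ω | ∃ i, ε < |u ⬝ᵥ w i - (T ω *ᵥ u) ⬝ᵥ (T ω *ᵥ w i)|} with hbad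
  set good := {ω |
    LPProjection.optValue c (LPProjection.primalFeasible A b) - δ ≤
        LPProjection.optValue c (LPProjection.projectedFeasible (T ω) A b θ) ∧
      LPProjection.optValue c (LPProjection.projectedFeasible (T ω) A b θ) ≤
        LPProjection.optValue c (LPProjection.primalFeasible A b)}
  have hgood : ∀ ω, ω ∉ bad → ω ∈ good := by
    intro ω hω
    simp only [hbad, Set.mem_ofPred_eq, not_exists, not_lt] at hω
    have hprod : ∀ i, |y ⬝ᵥ w i - (T ω *ᵥ y) ⬝ᵥ (T ω *ᵥ w i)| ≤ N * ε := by
      intro i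
      rw [hyu, Matrix.mulVec_smul, smul_dotProduct, smul_dotProduct, smul_eq_mul, smul_eq_mul,
        ← mul_sub, abs_mul, abs_of_pos hN0]
      exact mul_le_mul_of_nonneg_left (hω i) hN0.le
    refine LPProjection.optValue_projectedFeasible_bounds hx hxθ.le hy.1.1 hdual fun z hz => ?_
    refine le_trans ?_ (LPProjection.neg_le_dotProduct_residual (hprod none)
      (fun j => hprod (some j)) hz)
    have h1 : θ + 1 ≤ 2 * θ ^ 2 := by nlinarith
    have h2 : N * ε * (θ + 1) ≤ N * ε * (2 * θ ^ 2) :=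
      mul_le_mul_of_nonneg_left h1 (by positivity)
    linarith
  -- Subadditivity replaces passing to complements, so no measurability of the two events is needed.
  have htotal : 1 ≤ μ.real good + μ.real bad := by
    rw [← probReal_univ (μ := μ)]
    refine (measureReal_mono fun ω _ => ?_).trans (measureReal_union_le good bad)
    by_cases hω : ω ∈ bad
    exacts [Or.inr hω, Or.inl (hgood ω hω)]
  set s := C / 2 * ε ^ 2 * k
  have hexp : Real.exp (-s) ≤ Real.exp (-(C / 2) * (ε ^ 2 - ε ^ 3) * k) := by
    refine Real.exp_le_exp.2 ?_
    have : 0 ≤ C / 2 * ε ^ 3 * k := by positivity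
    simp only [s]
    linarith
  have hmain : 1 - 4 * (n : ℝ) * Real.exp (-s) ≤ μ.real good := by
    rcases LPProjection.one_sub_le_one_sub_of_half_exponent hn s with h | h
    · exact h.trans measureReal_nonneg
    · rw [Fintype.card_option, Fintype.card_fin, Nat.cast_add, Nat.cast_one,
        show -C * ε ^ 2 * k = -(2 * s) by simp only [s]; ring] at hprob
      linarith
  refine le_trans ?_ hmain
  gcongr
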